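/- **Theorem (length-generating function for $S\mathbb F_q\langle\!\langle\mathcal X\rangle\!\rangle^*_{rat}$).** *Series.* Let $\mathcal X$ be a finite totally ordered set and $\mathcal X^*$ the free monoid of words on $\mathcal X$, with empty word $\emptyset$. For a field $\mathbb K$ let $\mathbb K\langle\!\langle\mathcal X\rangle\!\rangle$ be the algebra of formal power series $A=\sum_{\mathbf X\in\mathcal X^*}(A,\mathbf X)\mathbf X$ in the non-commuting variables $\mathcal X$, with the convolution product. The subalgebra $\mathbb K\langle\!\langle\mathcal X\rangle\!\rangle_{rat}$ of rational series is the smallest subalgebra containing $\mathcal X$ and containing the inverse of each of its elements that is invertible in $\mathbb K\langle\!\langle\mathcal X\rangle\!\rangle$. Let $S\mathbb K\langle\!\langle\mathcal X\rangle\!\rangle^*_{rat}$ be the group of rational invertible series with constant coefficient $1$. For $\mathbf T\in\mathcal X^*$ put $\rho(\mathbf T)A=\sum_{\mathbf X}(A,\mathbf X\mathbf T)\mathbf X$, let $\overline A$ be the span of all $\rho(\mathbf T)A$, $\mathbf T\in\mathcal X^*$, and for $A\in S\mathbb K\langle\!\langle\mathcal X\rangle\!\rangle^*_{rat}$ let $\|A\|=\dim(\overline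 A+\mathbb K)-1$; this dimension is finite. *Trees.* View $\mathcal X^*$ as a tree rooted at $\emptyset$ in which the children of $\mathbf X$ are the words $X\mathbf X$, $X\in\mathcal X$. Order $\mathcal X^*$ totally by the right-to-left lexicographic order: $\mathbf Z<\mathbf XX\mathbf Z<\mathbf YY\mathbf Z$ for all $\mathbf X,\mathbf Y,\mathbf Z\in\mathcal X^*$ and all $X<Y$ in $\mathcal X$. Let $\mathcal{FFT}(\mathcal X)$ be the set of finite full subtrees: finite sets $T$ of words that contain $\emptyset$, contain $\mathbf X$ whenever they contain some $X\mathbf X$, and contain all children of a vertex whenever they contain one of them. Write $V(T)$ for the vertices of $T$, $\partial V(T)$ for its leaves (vertices without a child in $T$), and $V^\circ(T)$ for its interior vertices (the others); write $T'<T$ if $V^\circ(T')\subsetneq V^\circ(T)$. *Polynomials.* Define $F_T(q)\in\mathbb Z[q]$ recursively by $$F_T(q)=q^{\sharp V(T)-1}\prod_{\mathbf L\in\partial V(T)}q^{\sharp\{\mathbf Y\in V^\circ(T)\,:\,\mathbf Y<\mathbf L\}}-\sum_{T'<T}F_{T'}(q)\prod_{\mathbf L\in\partial V(T)}q^{\sharp\{\mathbf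 Y\in V^\circ(T)\setminus V^\circ(T')\,:\,\mathbf Y<\mathbf L\}},$$ and let $F_n(q)=\sum_{T\in\mathcal{FFT}(\mathcal X),\ \sharp V^\circ(T)=n}F_T(q)$ (a finite sum). *Claim.* For every finite field $\mathbb F_q$ with $q$ elements, $$\sum_{A\in S\mathbb F_q\langle\!\langle\mathcal X\rangle\!\rangle^*_{rat}}t^{\|A\|}=\sum_{T\in\mathcal{FFT}(\mathcal X)}F_T(q)\,t^{\sharp V^\circ(T)}$$ in $\mathbb Z[[t]]$, where both sums converge coefficientwise. In particular, for every $n\ge 0$ the number of $A\in S\mathbb F_q\langle\!\langle\mathcal X\rangle\!\rangle^*_{rat}$ with $\|A\|=n$ is finite and equal to $F_n(q)$. -/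

import Mathlib

open scoped PowerSeries.WithPiTopology

/-! ### Formal power series in non-commuting variables -/

/-- `NCSeries K X` is the algebra of formal power series in the non-commuting variables `X` with
coefficients in `K`: a series `A` is its coefficient function on the free monoid of words.
A word is a list of letters, written from left to right; the product of words is `++` and the
empty word is `[]`. -/
def NCSeries (K : Type*) (X : Type*) : Type _ := List X → K

namespace NCSeries

@[ext] theorem ext {K X : Type*} {A B : NCSeries K X} (h : ∀ w, A w = B w) : A = B := funext h

variable {K : Type*} {X : Type*} [Field K]

instance : AddCommGroup (NCSeries K X) := inferInstanceAs (AddCommGroup (List X → K))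

instance : Module K (NCSeries K X) := inferInstanceAs (Module K (List X → K))

/-- The constant series `1`. -/
instance : One (NCSeries K X) := ⟨fun w => if w.length = 0 then 1 else 0⟩

/-- The convolution product: the coefficient of `A * B` at the word `w` is the sum, over all
factorisations `w = u ++ v`, of `A u * B v`. -/
instance : Mul (NCSeries K X) :=
  ⟨fun A B w => ∑ i ∈ Finset.range (w.length + 1), A (w.take i) * B (w.drop i)⟩

theorem add_apply (A B : NCSeries K X) (w : List X) : (A + B) w = A w + B w := rfl

theorem smul_apply (c : K) (A : NCSeries K X) (w : List X) : (c • A) w = c * A w := rfl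

theorem zero_apply (w : List X) : (0 : NCSeries K X) w = 0 := rfl

theorem one_nil : (1 : NCSeries K X) [] = 1 := rfl

theorem one_cons (x : X) (w : List X) : (1 : NCSeries K X) (x :: w) = 0 := rfl

theorem mul_apply (A B : NCSeries K X) (w : List X) :
    (A * B) w = ∑ i ∈ Finset.range (w.length + 1), A (w.take i) * B (w.drop i) := rfl

/-- Auxiliary: the series with coefficient function `w ↦ A (x :: w)`. -/
def tailSeries (x : X) (A : NCSeries K X) : NCSeries K X := fun w => A (x :: w)

theorem mul_nil (A B : NCSeries K X) : (A * B) [] = A [] * B [] := by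
  simp [mul_apply]

theorem mul_cons (A B : NCSeries K X) (x : X) (w : List X) :
    (A * B) (x :: w) = (tailSeries x A * B) w + A [] * B (x :: w) := by
  rw [mul_apply, List.length_cons, Finset.sum_range_succ']
  rfl

theorem tailSeries_mul (A B : NCSeries K X) (x : X) :
    tailSeries x (A * B) = tailSeries x A * B + A [] • tailSeries x B := by
  ext w
  exact mul_cons A B x w

theorem add_mul_aux (A B C : NCSeries K X) : (A + B) * C = A * C + B * C := by
  ext w
  simp only [mul_apply, add_apply, add_mul, Finset.sum_add_distrib]

theorem mul_add_aux (A B C : NCSeries K X) : A * (B + C) = A * B + A * C := by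
  ext w
  simp only [mul_apply, add_apply, mul_add, Finset.sum_add_distrib]

theorem smul_mul_aux (c : K) (A B : NCSeries K X) : c • A * B = c • (A * B) := by
  ext w
  simp only [mul_apply, smul_apply, Finset.mul_sum, mul_assoc]

theorem mul_smul_aux (c : K) (A B : NCSeries K X) : A * c • B = c • (A * B) := by
  ext w
  simp only [mul_apply, smul_apply, Finset.mul_sum, mul_left_comm]

theorem zero_mul_aux (A : NCSeries K X) : 0 * A = 0 := by
  ext w
  simp [mul_apply, zero_apply]

theorem mul_zero_aux (A : NCSeries K X) : A * 0 = 0 := by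
  ext w
  simp [mul_apply, zero_apply]

theorem one_mul_aux (A : NCSeries K X) : 1 * A = A := by
  ext w
  cases w with
  | nil => simp [mul_nil, one_nil]
  | cons x w =>
    have h : tailSeries x (1 : NCSeries K X) = 0 := by
      ext v
      rfl
    rw [mul_cons, h, zero_mul_aux, zero_apply, one_nil, one_mul, zero_add]

theorem mul_one_aux (A : NCSeries K X) : A * 1 = A := by
  ext w
  induction w generalizing A with
  | nil => simp [mul_nil, one_nil]
  | cons x w ih => rw [mul_cons, ih, one_cons, mul_zero, add_zero]; rfl

theorem mul_assoc_aux (A B C : NCSeries K X) : A * B * C = A * (B * C) := by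
  ext w
  induction w generalizing A with
  | nil => simp only [mul_nil, mul_assoc]
  | cons x w ih =>
    rw [mul_cons, tailSeries_mul, add_mul_aux, add_apply, ih, smul_mul_aux, smul_apply, mul_nil,
      mul_cons A (B * C), mul_cons B C]
    ring

instance : Ring (NCSeries K X) :=
  { (inferInstance : AddCommGroup (NCSeries K X)) with
    one := 1
    mul := (· * ·)
    left_distrib := mul_add_aux
    right_distrib := add_mul_aux
    zero_mul := zero_mul_aux
    mul_zero := mul_zero_aux
    mul_assoc := mul_assoc_aux
    one_mul := one_mul_aux
    mul_one := mul_one_aux }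

instance : Algebra K (NCSeries K X) := Algebra.ofModule smul_mul_aux mul_smul_aux

/-- The augmentation map: the constant coefficient, as a ring homomorphism. -/
def augmentation : NCSeries K X →+* K where
  toFun A := A []
  map_one' := rfl
  map_zero' := rfl
  map_mul' := mul_nil
  map_add' _ _ := rfl

open Classical in
/-- The variable `x` as a series. -/
noncomputable def var (x : X) : NCSeries K X := fun w => if w = [x] then 1 else 0

/-- A subalgebra is rationally closed if it meets the group of units of the algebra of all series
in a subgroup, i.e. if it contains the inverse of each of its elements that is invertible as a
series. -/
def IsRationallyClosed (S : Subalgebra K (NCSeries K X)) : Prop :=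
  ∀ u : (NCSeries K X)ˣ, (u : NCSeries K X) ∈ S → ((u⁻¹ : (NCSeries K X)ˣ) : NCSeries K X) ∈ S

variable (K X) in
/-- The algebra of rational series: the smallest rationally closed subalgebra that contains all
variables (hence all non-commutative polynomials). -/
def rational : Subalgebra K (NCSeries K X) :=
  sInf {S | (∀ x, var x ∈ S) ∧ IsRationallyClosed S}

theorem rational_isRationallyClosed : IsRationallyClosed (rational K X) := by
  intro u hu
  rw [rational, Algebra.mem_sInf] at hu ⊢
  exact fun S hS => hS.2 u (hu S hS)

variable (K X) in
/-- The special group of rational units: the invertible series that are rational and have constant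
coefficient `1`. -/
def specialRationalUnits : Subgroup (NCSeries K X)ˣ where
  carrier := {u | (u : NCSeries K X) ∈ rational K X ∧ augmentation (u : NCSeries K X) = 1}
  one_mem' := ⟨one_mem _, map_one _⟩
  mul_mem' := by
    rintro a b ⟨ha, ha'⟩ ⟨hb, hb'⟩
    exact ⟨by simpa using mul_mem ha hb, by simp [ha', hb']⟩
  inv_mem' := by
    rintro a ⟨ha, ha'⟩
    refine ⟨rational_isRationallyClosed a ha, ?_⟩
    have h := map_mul augmentation (a : NCSeries K X) ((a⁻¹ : (NCSeries K X)ˣ) : NCSeries K X)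
    rw [Units.mul_inv, map_one, ha', one_mul] at h
    exact h.symm

/-- The shift by the word `T`: the coefficient of `shift T A` at `w` is that of `A` at `w ++ T`. -/
def shift (T : List X) (A : NCSeries K X) : NCSeries K X := fun w => A (w ++ T)

/-- The recursive closure of `A`: the vector space spanned by all shifts of `A`. -/
def recClosure (A : NCSeries K X) : Submodule K (NCSeries K X) :=
  Submodule.span K (Set.range fun T : List X => shift T A)

/-- The sum of the recursive closure of `A` and of the line of constant series. -/
def recClosureAddConst (A : NCSeries K X) : Submodule K (NCSeries K X) :=
  recClosure A ⊔ Submodule.span K {1}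

/-- The norm of `A`: the dimension of the sum of the recursive closure of `A` and of the constants,
minus one. -/
noncomputable def length (A : NCSeries K X) : ℕ :=
  Module.finrank K (recClosureAddConst A) - 1

end NCSeries

/-! ### Finite full subtrees of the rooted regular tree of words -/

/-- The right-to-left lexicographic order on words: with a common right end stripped off, the
shorter word comes first, and otherwise the last letters are compared. -/
def wordLT {X : Type*} [LinearOrder X] (v w : List X) : Prop := v.reverse < w.reverse

/-- A finite full subtree of the tree of words, in which the children of a word `w` are the words
`x :: w`, `x : X`, and the root is the empty word: a finite set of vertices that contains the root,
contains the parent of each of its non-root vertices, and contains all children of a vertex as soon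
as it contains one of them. -/
@[ext] structure FullTree (X : Type*) where
  verts : Finset (List X)
  root_mem : [] ∈ verts
  parent_mem : ∀ x w, x :: w ∈ verts → w ∈ verts
  full : ∀ x y w, x :: w ∈ verts → y :: w ∈ verts

namespace FullTree

variable {X : Type*}

open Classical in
/-- The interior vertices: the vertices that have a child in the tree. -/
noncomputable def interior (T : FullTree X) : Finset (List X) :=
  T.verts.filter fun w => ∃ x, x :: w ∈ T.verts

open Classical in
/-- The leaves: the vertices that have no child in the tree. -/
noncomputable def leaves (T : FullTree X) : Finset (List X) :=
  T.verts.filter fun w => ¬ ∃ x, x :: w ∈ T.verts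

theorem verts_subset_of_interior_subset {S T : FullTree X} (h : S.interior ⊆ T.interior) :
    S.verts ⊆ T.verts := by
  intro w hw
  cases w with
  | nil => exact T.root_mem
  | cons x w =>
    have h1 : w ∈ T.interior := h (by
      simp only [interior, Finset.mem_filter]
      exact ⟨S.parent_mem x w hw, x, hw⟩)
    simp only [interior, Finset.mem_filter] at h1
    obtain ⟨-, y, hy⟩ := h1
    exact T.full y x w hy

theorem verts_injective : Function.Injective (verts : FullTree X → Finset (List X)) :=
  fun _ _ h => FullTree.ext h

instance finite_smaller (T : FullTree X) :
    Finite {S : FullTree X // S.interior ⊂ T.interior} := by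
  refine Finite.of_injective
    (fun S => (⟨S.1.verts, Finset.mem_powerset.2 (verts_subset_of_interior_subset S.2.1)⟩ :
      T.verts.powerset)) ?_
  intro S S' h
  exact Subtype.ext (verts_injective (congrArg Subtype.val h))

theorem length_le_card_interior (T : FullTree X) {w : List X} (hw : w ∈ T.verts) :
    w.length ≤ T.interior.card := by
  have key : ∀ i < w.length, w.drop (i + 1) ∈ T.interior := by
    intro i hi
    have hd : ∀ j, w.drop j ∈ T.verts := by
      intro j
      induction j with
      | zero => simpa using hw
      | succ j ih =>
        by_cases hj : j < w.length
        · rw [List.drop_eq_getElem_cons hj] at ih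
          exact T.parent_mem _ _ ih
        · rw [List.drop_eq_nil_of_le (by omega)]
          exact T.root_mem
    simp only [interior, Finset.mem_filter]
    refine ⟨hd _, w[i], ?_⟩
    rw [← List.drop_eq_getElem_cons hi]
    exact hd i
  calc w.length = (Finset.range w.length).card := (Finset.card_range _).symm
    _ ≤ T.interior.card := by
      refine Finset.card_le_card_of_injOn (fun i => w.drop (i + 1))
        (fun i hi => key i (by simpa using hi)) ?_
      intro i hi j hj h
      have h' := congrArg List.length h
      simp only [List.length_drop, Finset.coe_range, Set.mem_Iio] at h' hi hj
      omega

instance finite_of_card [Finite X] (n : ℕ) :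
    Finite {T : FullTree X // T.interior.card = n} := by
  have hfin : {w : List X | w.length ≤ n}.Finite := List.finite_length_le X n
  refine Finite.of_injective
    (fun T => (⟨T.1.verts, by
      rw [Finset.mem_powerset]
      intro w hw
      rw [Set.Finite.mem_toFinset]
      exact (length_le_card_interior T.1 hw).trans T.2.le⟩ : hfin.toFinset.powerset)) ?_
  intro S S' h
  exact Subtype.ext (verts_injective (congrArg Subtype.val h))

variable [LinearOrder X]

open Classical in
/-- For a finite set `V` of words and a tree `T`, the sum over all leaves `L` of `T` of the number
of words in `V` that are smaller than `L`. -/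
noncomputable def countBelow (T : FullTree X) (V : Finset (List X)) : ℕ :=
  ∑ L ∈ T.leaves, (V.filter fun Y => wordLT Y L).card

attribute [local instance] Fintype.ofFinite in
open Classical in
/-- The polynomial `F_T`, defined by recursion on the number of interior vertices of `T`: from the
number `q ^ (#V(T) - 1) * ∏ L, q ^ #{Y ∈ V°(T) | Y < L}` of all tree G-presentations with underlying
tree `T`, one subtracts the sum over all smaller trees `S` of `F_S` times
`∏ L, q ^ #{Y ∈ V°(T) \ V°(S) | Y < L}`; here `L` runs over the leaves of `T`. -/
noncomputable def F (T : FullTree X) : Polynomial ℤ :=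
  Polynomial.X ^ (T.verts.card - 1) * Polynomial.X ^ T.countBelow T.interior -
    ∑ S : {S : FullTree X // S.interior ⊂ T.interior},
      F S.1 * Polynomial.X ^ T.countBelow (T.interior \ S.1.interior)
termination_by T.interior.card
decreasing_by exact Finset.card_lt_card S.2

attribute [local instance] Fintype.ofFinite in
variable (X) in
/-- The polynomial `F_n`: the sum of all `F_T` over the finite full subtrees `T` with exactly `n`
interior vertices. -/
noncomputable def Fsum [Finite X] (n : ℕ) : Polynomial ℤ :=
  ∑ T : {T : FullTree X // T.interior.card = n}, F T.1

end FullTree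

/-! Let m be the number of letters and let the free algebra K⟨X⟩ act on series by shifts. For a
series A, the elements that send A to a constant form a left ideal `annihilator A`. A is rational if
and only if this ideal has finite codimension (`mem_rational_iff`, `isRecognizable_iff`,
`finiteDimensional_quotient_annihilator_iff`), and the codimension is then the length of A
(`finrank_quotient_annihilator`).

Let a_n be the number of rational series with constant coefficient 1 and length n, and count in two
ways the pairs (I, A) where I is a left ideal of codimension n contained in `annihilator A`. For
fixed I, the series A amounts to m arbitrary functionals on K⟨X⟩/I, which gives q^(mn) choices
(`card_annihilated`). For fixed A of length j, one needs the number of left ideals of codimension n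
inside one of codimension j. By `ncard_subideals` it is E(mj+1-j, n-j), where E(r, k) stands for
`explorationCount q m 0 r k`. Hence the sum over j ≤ n of a_j E(mj+1-j, n-j) equals q^(mn) E(1, n).

To count subideals of I, consider the pairs of a representation of K⟨X⟩ on K^N and a linear map K⟨X⟩
→ K^N that is equivariant on I. They are easily parametrized, and sorting them by the intersection
of I with the kernel gives, for all N together, a triangular system for the numbers of subideals.
The numbers E(r, k) solve the same system (`explorationCount.sum_mul_prod`).

On the tree side, E(r, k) is the sum of the leaf weights over all trees that extend a tree with r
leaves by k interior vertices (`FullTree.sum_pow_countBelow`). Summing the definition of F_T over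
the trees T with n interior vertices shows that F_n(q) satisfies the recursion of a_n
(`FullTree.sum_Fsum_eval_mul`). Since E(r, 0) = 1, the recursion has only one solution. -/

namespace NCSeries

variable {K : Type*} {X : Type*}

/-! ### Recognizable series and their closure properties. -/

theorem shift_nil (A : NCSeries K X) : shift [] A = A := by
  ext w
  simp [shift]

variable [Field K]

/-- The shift by one letter, as a linear map. -/
def letterShift (x : X) : NCSeries K X →ₗ[K] NCSeries K X where
  toFun A := shift [x] A
  map_add' _ _ := rfl
  map_smul' _ _ := rfl

theorem letterShift_apply (x : X) (A : NCSeries K X) (w : List X) :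
    letterShift x A w = A (w ++ [x]) := rfl

theorem shift_cons (x : X) (T : List X) (A : NCSeries K X) :
    shift (x :: T) A = letterShift x (shift T A) := by
  ext w
  simp [shift, letterShift_apply]

theorem letterShift_one (x : X) : letterShift x (1 : NCSeries K X) = 0 := by
  ext w
  cases w <;> rfl

/-- The last letter of a factorised word belongs to the right factor, or to the left one if the
right factor is empty. This twisted Leibniz rule is behind the closure under products and inverses.
-/
theorem letterShift_mul (x : X) (A B : NCSeries K X) :
    letterShift x (A * B) = A * letterShift x B + B [] • letterShift x A := by
  ext w
  rw [letterShift_apply, mul_apply, add_apply, smul_apply, mul_apply, letterShift_apply,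
    List.length_append, List.length_singleton, Finset.sum_range_succ]
  congr 1
  · refine Finset.sum_congr rfl fun i hi => ?_
    have hi' : i ≤ w.length := Nat.lt_succ_iff.1 (Finset.mem_range.1 hi)
    rw [letterShift_apply, List.take_append_of_le_length hi', List.drop_append_of_le_length hi']
  · rw [List.take_of_length_le (by simp), List.drop_of_length_le (by simp), mul_comm]

/-- A series is recognizable if it lies in a finite-dimensional space of series that is stable under
all shifts by letters. -/
def IsRecognizable (A : NCSeries K X) : Prop :=
  ∃ U : Submodule K (NCSeries K X), FiniteDimensional K U ∧ A ∈ U ∧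
    ∀ x, ∀ B ∈ U, letterShift x B ∈ U

theorem letterShift_mem_recClosureAddConst (A : NCSeries K X) (x : X) {B : NCSeries K X}
    (hB : B ∈ recClosureAddConst A) : letterShift x B ∈ recClosureAddConst A := by
  have h : recClosureAddConst A ≤ (recClosureAddConst A).comap (letterShift x) := by
    refine sup_le (Submodule.span_le.2 ?_) (Submodule.span_le.2 ?_)
    · rintro _ ⟨T, rfl⟩
      exact Submodule.mem_sup_left (Submodule.subset_span ⟨x :: T, shift_cons x T A⟩)
    · rintro _ rfl
      change letterShift x (1 : NCSeries K X) ∈ recClosureAddConst A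
      rw [letterShift_one]
      exact zero_mem _
  exact h hB

theorem mem_recClosureAddConst (A : NCSeries K X) : A ∈ recClosureAddConst A :=
  Submodule.mem_sup_left (Submodule.subset_span ⟨[], shift_nil A⟩)

/-- The space `recClosureAddConst A` is stable under shifts. Conversely, every stable space
containing A contains its recursive closure, and the constants add at most one dimension. -/
theorem isRecognizable_iff {A : NCSeries K X} :
    IsRecognizable A ↔ FiniteDimensional K (recClosureAddConst A) := by
  constructor
  · rintro ⟨U, hU, hA, hst⟩
    have h : recClosure A ≤ U := by
      refine Submodule.span_le.2 ?_
      rintro _ ⟨T, rfl⟩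
      change shift T A ∈ U
      induction T with
      | nil => rwa [shift_nil]
      | cons x T ih => rw [shift_cons]; exact hst x _ ih
    exact Submodule.finiteDimensional_of_le (sup_le_sup_right h (Submodule.span K {1}))
  · intro h
    exact ⟨_, h, mem_recClosureAddConst A, fun x B hB => letterShift_mem_recClosureAddConst A x hB⟩

theorem isRecognizable_smul_one (c : K) : IsRecognizable (c • (1 : NCSeries K X)) := by
  refine ⟨Submodule.span K {1}, inferInstance,
    Submodule.smul_mem _ _ (Submodule.subset_span rfl), fun x B hB => ?_⟩
  obtain ⟨a, rfl⟩ := Submodule.mem_span_singleton.1 hB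
  rw [map_smul, letterShift_one, smul_zero]
  exact zero_mem _

theorem IsRecognizable.add {A B : NCSeries K X} (hA : IsRecognizable A) (hB : IsRecognizable B) :
    IsRecognizable (A + B) := by
  obtain ⟨U, hU, hAU, hst⟩ := hA
  obtain ⟨U', hU', hBU, hst'⟩ := hB
  refine ⟨U ⊔ U', inferInstance, Submodule.add_mem_sup hAU hBU, fun x C hC => ?_⟩
  obtain ⟨C₁, h₁, C₂, h₂, rfl⟩ := Submodule.mem_sup.1 hC
  rw [map_add]
  exact Submodule.add_mem_sup (hst x _ h₁) (hst' x _ h₂)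

/-- If U and U' are stable spaces for A and B, then A·U' + U is stable by `letterShift_mul`. -/
theorem IsRecognizable.mul {A B : NCSeries K X} (hA : IsRecognizable A) (hB : IsRecognizable B) :
    IsRecognizable (A * B) := by
  obtain ⟨U, hU, hAU, hst⟩ := hA
  obtain ⟨U', hU', hBU, hst'⟩ := hB
  refine ⟨U'.map (LinearMap.mulLeft K A) ⊔ U, inferInstance,
    Submodule.mem_sup_left ⟨B, hBU, rfl⟩, fun x C hC => ?_⟩
  obtain ⟨_, ⟨C₁, h₁, rfl⟩, C₂, h₂, rfl⟩ := Submodule.mem_sup.1 hC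
  rw [map_add, LinearMap.mulLeft_apply, letterShift_mul, add_assoc]
  exact Submodule.add_mem_sup ⟨_, hst' x _ h₁, rfl⟩
    (add_mem (U.smul_mem _ (hst x _ hAU)) (hst x _ h₂))

theorem letterShift_unit_inv (x : X) (u : (NCSeries K X)ˣ) :
    letterShift x (↑u⁻¹ : NCSeries K X) =
      (↑u⁻¹ : NCSeries K X) * -((↑u⁻¹ : NCSeries K X) [] • letterShift x (u : NCSeries K X)) := by
  have h := letterShift_mul x (u : NCSeries K X) (↑u⁻¹ : NCSeries K X)
  rw [Units.mul_inv, letterShift_one] at h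
  rw [← Units.inv_mul_cancel_left u (letterShift x (↑u⁻¹ : NCSeries K X)),
    eq_neg_of_add_eq_zero_left h.symm]

/-- For a stable space U of u, the space u⁻¹U + K u⁻¹ works: letter shifts send all of it into u⁻¹U.
-/
theorem IsRecognizable.inv {u : (NCSeries K X)ˣ} (hu : IsRecognizable (u : NCSeries K X)) :
    IsRecognizable (↑u⁻¹ : NCSeries K X) := by
  obtain ⟨U, hU, hAU, hst⟩ := hu
  refine ⟨U.map (LinearMap.mulLeft K (↑u⁻¹ : NCSeries K X)) ⊔ Submodule.span K {↑u⁻¹},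
    inferInstance, Submodule.mem_sup_right (Submodule.subset_span rfl), fun x C hC => ?_⟩
  have key : letterShift x (↑u⁻¹ : NCSeries K X) ∈
      U.map (LinearMap.mulLeft K (↑u⁻¹ : NCSeries K X)) := by
    rw [letterShift_unit_inv]
    exact ⟨_, neg_mem (U.smul_mem _ (hst x _ hAU)), rfl⟩
  obtain ⟨_, ⟨C₁, h₁, rfl⟩, C₂, h₂, rfl⟩ := Submodule.mem_sup.1 hC
  obtain ⟨a, rfl⟩ := Submodule.mem_span_singleton.1 h₂
  rw [map_add, map_smul, LinearMap.mulLeft_apply, letterShift_mul]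
  exact Submodule.mem_sup_left (add_mem (add_mem ⟨_, hst x _ h₁, rfl⟩ (Submodule.smul_mem _ _ key))
    (Submodule.smul_mem _ _ key))

theorem isRecognizable_var (x : X) : IsRecognizable (var x : NCSeries K X) := by
  refine ⟨Submodule.span K {1} ⊔ Submodule.span K {var x}, inferInstance,
    Submodule.mem_sup_right (Submodule.subset_span rfl), fun y B hB => ?_⟩
  obtain ⟨B₁, h₁, B₂, h₂, rfl⟩ := Submodule.mem_sup.1 hB
  obtain ⟨a, rfl⟩ := Submodule.mem_span_singleton.1 h₁
  obtain ⟨b, rfl⟩ := Submodule.mem_span_singleton.1 h₂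
  have h : letterShift y (var x : NCSeries K X) ∈ Submodule.span K {(1 : NCSeries K X)} := by
    classical
    refine Submodule.mem_span_singleton.2 ⟨if y = x then 1 else 0, ?_⟩
    ext w
    rw [letterShift_apply, smul_apply]
    cases w with
    | nil => simp [var, one_nil]
    | cons z w => simp [var, one_cons]
  rw [map_add, map_smul, map_smul, letterShift_one, smul_zero, zero_add]
  exact Submodule.mem_sup_left (Submodule.smul_mem _ _ h)

variable (K X) in
/-- The subalgebra of recognizable series. -/
def recognizable : Subalgebra K (NCSeries K X) where
  carrier := {A | IsRecognizable A}
  mul_mem' := IsRecognizable.mul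
  add_mem' := IsRecognizable.add
  algebraMap_mem' c := by
    rw [Algebra.algebraMap_eq_smul_one]
    exact isRecognizable_smul_one c

theorem isRecognizable_of_mem_rational {A : NCSeries K X} (hA : A ∈ rational K X) :
    IsRecognizable A :=
  Algebra.mem_sInf.1 hA (recognizable K X) ⟨isRecognizable_var, fun _ hu => hu.inv⟩

/-! ### Rationality of recognizable series. -/

/-- The right inverse of a series with constant coefficient `1`. -/
def rightInverse (A : NCSeries K X) : List X → K
  | [] => 1
  | x :: w => -∑ i : Fin (w.length + 1), A (x :: w.take i) * rightInverse A (w.drop i)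
termination_by w => w.length
decreasing_by simp

theorem mul_rightInverse {A : NCSeries K X} (hA : A [] = 1) :
    A * (show NCSeries K X from rightInverse A) = 1 := by
  ext w
  cases w with
  | nil =>
    rw [mul_nil, hA, one_mul, one_nil]
    exact rightInverse.eq_1 A
  | cons x w =>
    have h : rightInverse A (x :: w) = _ := rightInverse.eq_2 A x w
    rw [mul_cons, hA, one_mul, one_cons, h, mul_apply,
      Finset.sum_range fun i => tailSeries x A (w.take i) * rightInverse A (w.drop i)]
    exact add_neg_cancel _

/-- A right inverse B of A also has constant coefficient 1, hence a right inverse C of its own, and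
A = A(BC) = (AB)C = C. -/
theorem isUnit_of_nil_eq_one {A : NCSeries K X} (hA : A [] = 1) : IsUnit A := by
  obtain ⟨B, hB⟩ : ∃ B : NCSeries K X, A * B = 1 := ⟨_, mul_rightInverse hA⟩
  have hB' : B [] = 1 := by
    have h := mul_nil A B
    rwa [hB, hA, one_mul, one_nil, eq_comm] at h
  obtain ⟨C, hC⟩ : ∃ C : NCSeries K X, B * C = 1 := ⟨_, mul_rightInverse hB'⟩
  have h : A = C := by rw [← mul_one A, ← hC, ← mul_assoc, hB, one_mul]
  exact ⟨⟨A, B, hB, h ▸ hC⟩, rfl⟩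

theorem var_mem_rational (x : X) : var x ∈ rational K X :=
  Algebra.mem_sInf.2 fun _ hS => hS.1 x

/-- A linear system over the rational series whose matrix has no constant coefficients has rational
solutions only. -/
theorem mem_rational_of_linearSystem {n : ℕ} (A c : Fin n → NCSeries K X)
    (p : Fin n → Fin n → NCSeries K X) (hc : ∀ i, c i ∈ rational K X)
    (hp : ∀ i j, p i j ∈ rational K X) (hp0 : ∀ i j, p i j [] = 0)
    (h : ∀ i, A i = c i + ∑ j, A j * p i j) (i : Fin n) : A i ∈ rational K X := by
  induction n with
  | zero => exact i.elim0
  | succ n ih =>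
    -- Gaussian elimination: equation 0 is solved for `A 0` by means of the rational inverse of 1 -
    -- `p 0 0`, and substituted into the others. The new matrix again has no constant coefficients.
    obtain ⟨u, hu⟩ : IsUnit (1 - p 0 0) := isUnit_of_nil_eq_one (by
      change (1 : NCSeries K X) [] - p 0 0 [] = 1
      rw [hp0, one_nil, sub_zero])
    have huinv : (↑u⁻¹ : NCSeries K X) ∈ rational K X :=
      rational_isRationallyClosed u (hu ▸ sub_mem (one_mem _) (hp 0 0))
    have h0 : A 0 = (c 0 + ∑ j : Fin n, A j.succ * p 0 j.succ) * ↑u⁻¹ := by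
      rw [Units.eq_mul_inv_iff_mul_eq, hu, mul_sub, mul_one, sub_eq_iff_eq_add]
      conv_lhs => rw [h 0, Fin.sum_univ_succ]
      abel
    have hs : ∀ j : Fin n, A j.succ ∈ rational K X := by
      refine fun j => ih (fun j => A j.succ) (fun j => c j.succ + c 0 * (↑u⁻¹ * p j.succ 0))
        (fun i j => p i.succ j.succ + p 0 j.succ * (↑u⁻¹ * p i.succ 0))
        (fun i => add_mem (hc _) (mul_mem (hc _) (mul_mem huinv (hp _ _))))
        (fun i j => add_mem (hp _ _) (mul_mem (hp _ _) (mul_mem huinv (hp _ _))))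
        (fun i j => ?_) (fun i => ?_) j
      · rw [add_apply, mul_nil, mul_nil, hp0, hp0, zero_mul, add_zero]
      · rw [h i.succ, Fin.sum_univ_succ, h0]
        simp only [mul_add, add_mul, Finset.sum_add_distrib, Finset.sum_mul, mul_assoc]
        abel
    refine Fin.cases ?_ hs i
    rw [h0]
    exact mul_mem (add_mem (hc 0) (sum_mem fun j _ => mul_mem (hs j) (hp _ _))) huinv

theorem mul_var_nil (A : NCSeries K X) (x : X) : (A * var x : NCSeries K X) [] = 0 := by
  simp [mul_nil, var]

theorem mul_var_append (A : NCSeries K X) (x y : X) (w : List X) [DecidableEq X] :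
    (A * var x : NCSeries K X) (w ++ [y]) = if y = x then A w else 0 := by
  classical
  have h : letterShift y (var x : NCSeries K X) = if y = x then 1 else 0 := by
    ext w
    rw [letterShift_apply]
    split_ifs with hxy
    · cases w <;> simp [var, one_nil, one_cons, hxy]
    · cases w <;> simp [var, zero_apply, hxy]
  change letterShift y (A * var x) w = _
  rw [letterShift_mul, h, add_apply, smul_apply]
  split_ifs <;> simp [var, zero_apply]

theorem eq_add_sum_letterShift_mul_var [Fintype X] (A : NCSeries K X) :
    A = A [] • 1 + ∑ x, letterShift x A * var x := by
  classical
  have hsum : ∀ w, (∑ x, letterShift x A * var x : NCSeries K X) w =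
      ∑ x, (letterShift x A * var x : NCSeries K X) w := fun w => Finset.sum_apply w _ _
  ext w
  rw [add_apply, smul_apply, hsum]
  rcases List.eq_nil_or_concat' w with rfl | ⟨w, y, rfl⟩
  · simp [mul_var_nil, one_nil]
  · have h1 : (1 : NCSeries K X) (w ++ [y]) = 0 := by cases w <;> rfl
    simp [mul_var_append, h1, letterShift_apply]

/-- Sorting words by their last letter (`eq_add_sum_letterShift_mul_var`) turns a basis of a stable
space into the solution of a linear system whose matrix entries are linear combinations of
variables. -/
theorem IsRecognizable.mem_rational [Fintype X] {A : NCSeries K X} (hA : IsRecognizable A) :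
    A ∈ rational K X := by
  obtain ⟨U, hU, hAU, hst⟩ := hA
  let b := Module.finBasis K U
  have hb : ∀ i, (b i : NCSeries K X) ∈ rational K X := by
    refine mem_rational_of_linearSystem (fun i => (b i : NCSeries K X))
      (fun i => (b i : NCSeries K X) [] • 1)
      (fun i j => ∑ x, b.repr ⟨letterShift x (b i : NCSeries K X), hst x _ (b i).2⟩ j • var x)
      (fun i => Subalgebra.smul_mem _ (one_mem _) _)
      (fun i j => sum_mem fun x _ => Subalgebra.smul_mem _ (var_mem_rational x) _) ?_ ?_
    · intro i j
      refine (Finset.sum_apply _ _ _).trans (Finset.sum_eq_zero fun x _ => ?_)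
      rw [smul_apply]
      simp [var]
    · intro i
      conv_lhs => rw [eq_add_sum_letterShift_mul_var (b i : NCSeries K X)]
      congr 1
      simp only [Finset.mul_sum]
      rw [Finset.sum_comm]
      refine Finset.sum_congr rfl fun x _ => ?_
      have h := congrArg Subtype.val
        (b.sum_repr ⟨letterShift x (b i : NCSeries K X), hst x _ (b i).2⟩)
      rw [Submodule.coe_sum] at h
      change _ = letterShift x (b i : NCSeries K X) at h
      conv_lhs => rw [← h]
      rw [Finset.sum_mul]
      refine Finset.sum_congr rfl fun j _ => ?_
      rw [Submodule.coe_smul, smul_mul_assoc, mul_smul_comm]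
  have h := congrArg (Subtype.val) (b.sum_repr ⟨A, hAU⟩)
  rw [Submodule.coe_sum] at h
  change _ = A at h
  rw [← h]
  exact sum_mem fun i _ => Subalgebra.smul_mem _ (hb i) _

theorem mem_rational_iff [Fintype X] {A : NCSeries K X} :
    A ∈ rational K X ↔ IsRecognizable A :=
  ⟨isRecognizable_of_mem_rational, IsRecognizable.mem_rational⟩

end NCSeries

/-! ### Counting by exploration -/

/-- The weighted number of ways to explore `r` pending vertices, of which `k` vertices in all are
expanded and then replaced by `m` new pending vertices, when `s` vertices have already been expanded;
a pending vertex that is not expanded has the weight `q ^ e`, where `e` is the number of vertices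
expanded before. -/
def explorationCount (q m : ℕ) : ℕ → ℕ → ℕ → ℤ
  | _, 0, 0 => 1
  | _, 0, _ + 1 => 0
  | s, r + 1, 0 => q ^ s * explorationCount q m s r 0
  | s, r + 1, k + 1 =>
    q ^ s * explorationCount q m s r (k + 1) + explorationCount q m (s + 1) (r + m) k
termination_by _ r k => (k, r)

namespace explorationCount

variable {q m : ℕ}

theorem zero_zero (s : ℕ) : explorationCount q m s 0 0 = 1 := by
  rw [explorationCount]

theorem zero_succ (s k : ℕ) : explorationCount q m s 0 (k + 1) = 0 := by
  rw [explorationCount]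

theorem succ_zero (s r : ℕ) :
    explorationCount q m s (r + 1) 0 = q ^ s * explorationCount q m s r 0 := by
  rw [explorationCount]

theorem succ_succ (s r k : ℕ) : explorationCount q m s (r + 1) (k + 1) =
    q ^ s * explorationCount q m s r (k + 1) + explorationCount q m (s + 1) (r + m) k := by
  rw [explorationCount]

theorem apply_zero (s r : ℕ) : explorationCount q m s r 0 = (q : ℤ) ^ (s * r) := by
  induction r with
  | zero => simp [zero_zero]
  | succ r ih => rw [succ_zero, ih, ← pow_add, mul_add, mul_one, add_comm]

/-- Put N = s + d and let each pending vertex carry a vector of an N-dimensional space. It lies in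
the span of the s independent vectors found before (q^s choices, no expansion) or outside of it (q^N
- q^s choices, expansion). The two branches of the recursion recombine through q^s + (q^N - q^s) =
q^N. -/
theorem sum_mul_prod (d s r : ℕ) :
    ∑ k ∈ Finset.range (d + 1), explorationCount q m s r k *
      (∏ i ∈ Finset.range k, ((q : ℤ) ^ (s + d) - (q : ℤ) ^ (s + i))) *
        (q : ℤ) ^ ((s + d) * m * (d - k)) = (q : ℤ) ^ ((s + d) * (r + m * d)) := by
  induction d generalizing s r with
  | zero => simp [apply_zero]
  | succ d ihd =>
    induction r with
    | zero =>
      rw [Finset.sum_range_succ', Finset.sum_eq_zero]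
      · rw [zero_zero]
        simp [mul_assoc]
      · intro k _
        rw [zero_succ, zero_mul, zero_mul]
    | succ r ihr =>
      have hd := ihd (s + 1) (r + m)
      rw [show s + 1 + d = s + (d + 1) by ring] at hd
      rw [Finset.sum_range_succ'] at ihr ⊢
      -- The term without expansions is kept apart because it has only one branch. In the other
      -- terms, the factor i = 0 of the product goes to the branch that expands the first vertex.
      have key : ∀ k ∈ Finset.range (d + 1), explorationCount q m s (r + 1) (k + 1) *
          (∏ i ∈ Finset.range (k + 1), ((q : ℤ) ^ (s + (d + 1)) - (q : ℤ) ^ (s + i))) *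
            (q : ℤ) ^ ((s + (d + 1)) * m * (d + 1 - (k + 1))) =
          (q : ℤ) ^ s * (explorationCount q m s r (k + 1) *
          (∏ i ∈ Finset.range (k + 1), ((q : ℤ) ^ (s + (d + 1)) - (q : ℤ) ^ (s + i))) *
            (q : ℤ) ^ ((s + (d + 1)) * m * (d + 1 - (k + 1)))) +
          ((q : ℤ) ^ (s + (d + 1)) - (q : ℤ) ^ s) * (explorationCount q m (s + 1) (r + m) k *
          (∏ i ∈ Finset.range k, ((q : ℤ) ^ (s + (d + 1)) - (q : ℤ) ^ (s + 1 + i))) *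
            (q : ℤ) ^ ((s + (d + 1)) * m * (d - k))) := by
        intro k _
        rw [succ_succ, Nat.add_sub_add_right, Finset.prod_range_succ', add_zero]
        simp only [add_assoc, add_comm 1]
        ring
      rw [Finset.sum_congr rfl key, Finset.sum_add_distrib, ← Finset.mul_sum, ← Finset.mul_sum, hd,
        succ_zero]
      calc _ = (q : ℤ) ^ s * _ + ((q : ℤ) ^ (s + (d + 1)) - (q : ℤ) ^ s) *
            (q : ℤ) ^ ((s + (d + 1)) * (r + m + m * d)) := by
            rw [mul_assoc ((q : ℤ) ^ s), mul_assoc ((q : ℤ) ^ s), add_right_comm, ← mul_add]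
        _ = _ := by
            rw [ihr]
            ring

/-- A sequence that satisfies the identities `sum_mul_prod` with `s = 0` is the sequence of
exploration counts. -/
theorem eq_of_sum_mul_prod (hq : 1 < q) (r : ℕ) (E : ℕ → ℤ)
    (hE : ∀ N, ∑ k ∈ Finset.range (N + 1), E k *
      (∏ i ∈ Finset.range k, ((q : ℤ) ^ N - (q : ℤ) ^ i)) * (q : ℤ) ^ (N * m * (N - k)) =
        (q : ℤ) ^ (N * (r + m * N))) (k : ℕ) : E k = explorationCount q m 0 r k := by
  induction k using Nat.strong_induction_on with
  | _ k ih =>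
    have h := hE k
    have h' := sum_mul_prod (q := q) (m := m) k 0 r
    simp only [zero_add] at h'
    rw [← h', Finset.sum_range_succ, Finset.sum_range_succ,
      Finset.sum_congr rfl fun j hj => by rw [ih j (Finset.mem_range.1 hj)], add_right_inj] at h
    -- The system is triangular; its diagonal coefficient does not vanish because q > 1.
    have hq0 : (q : ℤ) ^ (k * m * (k - k)) ≠ 0 := pow_ne_zero _ (by positivity)
    have hprod : ∏ i ∈ Finset.range k, ((q : ℤ) ^ k - (q : ℤ) ^ i) ≠ 0 :=
      Finset.prod_ne_zero_iff.2 fun i hi => sub_ne_zero.2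
        (pow_lt_pow_right₀ (by exact_mod_cast hq) (Finset.mem_range.1 hi)).ne'
    exact mul_right_cancel₀ hprod (mul_right_cancel₀ hq0 h)

end explorationCount

/-! ### Sums over finite full trees -/

namespace FullTree

variable {X : Type*}

theorem mem_interior {T : FullTree X} {w : List X} :
    w ∈ T.interior ↔ ∃ x, x :: w ∈ T.verts := by
  classical
  simp only [interior, Finset.mem_filter, and_iff_right_iff_imp]
  rintro ⟨x, hx⟩
  exact T.parent_mem x w hx

theorem mem_leaves {T : FullTree X} {w : List X} :
    w ∈ T.leaves ↔ w ∈ T.verts ∧ w ∉ T.interior := by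
  classical
  simp only [leaves, Finset.mem_filter, mem_interior]

theorem cons_mem_verts {T : FullTree X} {x : X} {w : List X} :
    x :: w ∈ T.verts ↔ w ∈ T.interior := by
  rw [mem_interior]
  exact ⟨fun h => ⟨x, h⟩, fun ⟨y, hy⟩ => T.full y x w hy⟩

theorem interior_subset_verts (T : FullTree X) : T.interior ⊆ T.verts := by
  intro w hw
  obtain ⟨x, hx⟩ := mem_interior.1 hw
  exact T.parent_mem x w hx

theorem mem_interior_of_cons_mem {T : FullTree X} {x : X} {w : List X}
    (h : x :: w ∈ T.interior) : w ∈ T.interior :=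
  cons_mem_verts.1 (T.interior_subset_verts h)

theorem interior_injective :
    Function.Injective (interior : FullTree X → Finset (List X)) := fun _ _ h =>
  verts_injective (Finset.Subset.antisymm (verts_subset_of_interior_subset h.le)
    (verts_subset_of_interior_subset h.ge))

/-- On the path from the root to Y, the first vertex that is not interior in S is a leaf of S. -/
theorem exists_suffix_mem_leaves {S T : FullTree X} {Y : List X} (hY : Y ∈ T.interior)
    (hS : Y ∉ S.interior) : ∃ u L, Y = u ++ L ∧ L ∈ S.leaves ∧ L ∈ T.interior := by
  induction Y with
  | nil => exact ⟨[], [], rfl, mem_leaves.2 ⟨S.root_mem, hS⟩, hY⟩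
  | cons x Y ih =>
    by_cases h : Y ∈ S.interior
    · exact ⟨[], x :: Y, rfl, mem_leaves.2 ⟨cons_mem_verts.2 h, hS⟩, hY⟩
    · obtain ⟨u, L, rfl, hL⟩ := ih (mem_interior_of_cons_mem hY) h
      exact ⟨x :: u, L, rfl, hL⟩

variable (X) in
/-- The tree that consists of the root. -/
def trivial : FullTree X where
  verts := {[]}
  root_mem := Finset.mem_singleton_self _
  parent_mem x w h := by simp at h
  full x y w h := by simp at h

theorem interior_trivial : (trivial X).interior = ∅ := by
  refine Finset.eq_empty_of_forall_notMem fun w hw => ?_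
  obtain ⟨x, hx⟩ := mem_interior.1 hw
  simp [trivial] at hx

/-! ### Vertex counts, and growing a tree at a leaf. -/

section Fintype

variable [Fintype X]

open Classical in
theorem verts_eq (T : FullTree X) : T.verts =
    insert [] ((Finset.univ ×ˢ T.interior).image fun p : X × List X => p.1 :: p.2) := by
  ext w
  cases w with
  | nil => simp [T.root_mem]
  | cons x w => simp [cons_mem_verts]

/-- A non-root vertex is given by its first letter and its parent, which is an arbitrary interior
vertex. -/
theorem card_verts (T : FullTree X) :
    T.verts.card = Fintype.card X * T.interior.card + 1 := by
  classical
  rw [verts_eq, Finset.card_insert_of_notMem (by simp), Finset.card_image_of_injective,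
    Finset.card_product, Finset.card_univ]
  rintro ⟨x, v⟩ ⟨y, w⟩ h
  simpa using h

theorem card_leaves_add_card_interior (T : FullTree X) :
    T.leaves.card + T.interior.card = Fintype.card X * T.interior.card + 1 := by
  classical
  have h : T.leaves = T.verts \ T.interior := by
    ext w
    rw [mem_leaves, Finset.mem_sdiff]
  rw [h, Finset.card_sdiff_add_card_eq_card T.interior_subset_verts, card_verts]

open Classical in
/-- The tree obtained by adding all children of a vertex. -/
noncomputable def grow (T : FullTree X) (L : List X) (hL : L ∈ T.verts) : FullTree X where
  verts := T.verts ∪ Finset.univ.image (· :: L)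
  root_mem := Finset.mem_union_left _ T.root_mem
  parent_mem x w h := by
    rcases Finset.mem_union.1 h with h | h
    · exact Finset.mem_union_left _ (T.parent_mem x w h)
    · obtain ⟨y, -, hy⟩ := Finset.mem_image.1 h
      obtain ⟨rfl, rfl⟩ := List.cons.inj hy
      exact Finset.mem_union_left _ hL
  full x y w h := by
    rcases Finset.mem_union.1 h with h | h
    · exact Finset.mem_union_left _ (T.full x y w h)
    · obtain ⟨z, -, hz⟩ := Finset.mem_image.1 h
      obtain ⟨rfl, rfl⟩ := List.cons.inj hz
      exact Finset.mem_union_right _ (Finset.mem_image_of_mem _ (Finset.mem_univ y))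

theorem mem_verts_grow {T : FullTree X} {L : List X} {hL : L ∈ T.verts} {w : List X} :
    w ∈ (T.grow L hL).verts ↔ w ∈ T.verts ∨ ∃ x, x :: L = w := by
  classical
  simp [grow]

variable [Nonempty X]

theorem mem_interior_grow {T : FullTree X} {L : List X} {hL : L ∈ T.verts} {w : List X} :
    w ∈ (T.grow L hL).interior ↔ w = L ∨ w ∈ T.interior := by
  obtain ⟨x⟩ := ‹Nonempty X›
  rw [← cons_mem_verts (x := x), mem_verts_grow, cons_mem_verts, or_comm]
  simp [eq_comm]

theorem mem_leaves_grow {T : FullTree X} {L : List X} (hL : L ∈ T.leaves) {w : List X} :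
    w ∈ (T.grow L (mem_leaves.1 hL).1).leaves ↔ (w ∈ T.leaves ∧ w ≠ L) ∨ ∃ x, x :: L = w := by
  have hL' := mem_leaves.1 hL
  rw [mem_leaves, mem_verts_grow, mem_interior_grow, mem_leaves]
  constructor
  · rintro ⟨h | h, h'⟩
    · exact Or.inl ⟨⟨h, fun h'' => h' (Or.inr h'')⟩, fun h'' => h' (Or.inl h'')⟩
    · exact Or.inr h
  · rintro (⟨⟨h, h'⟩, h''⟩ | ⟨x, rfl⟩)
    · exact ⟨Or.inl h, by tauto⟩
    · refine ⟨Or.inr ⟨x, rfl⟩, ?_⟩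
      rintro (h | h)
      · simp at h
      · exact hL'.2 (mem_interior_of_cons_mem h)

end Fintype

/-! ### The right-to-left lexicographic order. -/

section Order

variable [LinearOrder X]

theorem wordLT_cons (x : X) (w : List X) : wordLT w (x :: w) := by
  have h : ∀ (l : List X) (a : X), l < l ++ [a] := by
    intro l a
    induction l with
    | nil => simp
    | cons b l ih => simpa [List.cons_lt_cons_iff] using ih
  simpa [wordLT] using h w.reverse x

theorem wordLT_trans {u v w : List X} (h : wordLT u v) (h' : wordLT v w) : wordLT u w :=
  lt_trans (a := u.reverse) h h'

theorem not_wordLT_of_wordLT {u v : List X} (h : wordLT u v) : ¬ wordLT v u :=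
  lt_asymm (a := u.reverse) h

theorem wordLT_append {v w : List X} (h : wordLT v w) (u : List X) : wordLT v (u ++ w) := by
  induction u with
  | nil => exact h
  | cons x u ih => exact wordLT_trans ih (wordLT_cons x _)

theorem exists_wordLT_min {P : Finset (List X)} (hP : P.Nonempty) :
    ∃ L ∈ P, ∀ L' ∈ P, L' ≠ L → wordLT L L' := by
  obtain ⟨L, hL, h⟩ := Finset.exists_min_image P List.reverse hP
  exact ⟨L, hL, fun L' hL' hne => lt_of_le_of_ne (h L' hL') fun h' =>
    hne (List.reverse_injective h').symm⟩

end Order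

/-! ### Weighted sums over the extensions of a tree. -/

section Sum

variable (X) in
/-- The finite set of all finite full trees with `n` interior vertices. -/
noncomputable def treesWithCard [Finite X] (n : ℕ) : Finset (FullTree X) :=
  Set.Finite.toFinset (s := {T : FullTree X | T.interior.card = n}) (finite_of_card n)

theorem mem_treesWithCard [Finite X] {n : ℕ} {T : FullTree X} :
    T ∈ treesWithCard X n ↔ T.interior.card = n :=
  Set.Finite.mem_toFinset _

theorem treesWithCard_zero [Finite X] : treesWithCard X 0 = {trivial X} := by
  ext T
  rw [mem_treesWithCard, Finset.card_eq_zero, Finset.mem_singleton, ← interior_trivial,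
    interior_injective.eq_iff]

open Classical in
/-- The trees that extend `S` by `k` additional interior vertices and in which the vertices in `P`
are not interior. -/
noncomputable def extensions [Finite X] (S : FullTree X) (P : Finset (List X)) (k : ℕ) :
    Finset (FullTree X) :=
  (treesWithCard X (S.interior.card + k)).filter fun T =>
    S.interior ⊆ T.interior ∧ Disjoint P T.interior

theorem mem_extensions [Finite X] {S T : FullTree X} {P : Finset (List X)} {k : ℕ} :
    T ∈ S.extensions P k ↔ T.interior.card = S.interior.card + k ∧
      S.interior ⊆ T.interior ∧ Disjoint P T.interior := by
  classical
  rw [extensions, Finset.mem_filter, mem_treesWithCard]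

theorem extensions_zero [Finite X] {S : FullTree X} {P : Finset (List X)} (hP : P ⊆ S.leaves) :
    S.extensions P 0 = {S} := by
  ext T
  rw [mem_extensions, Finset.mem_singleton]
  constructor
  · rintro ⟨h, h', -⟩
    exact (interior_injective (Finset.eq_of_subset_of_card_le h' h.le)).symm
  · rintro rfl
    exact ⟨rfl, subset_rfl, Finset.disjoint_left.2 fun L hL => (mem_leaves.1 (hP hL)).2⟩

theorem extensions_succ_of_leaves_subset [Finite X] {S : FullTree X} {P : Finset (List X)}
    (hP : S.leaves ⊆ P) (k : ℕ) : S.extensions P (k + 1) = ∅ := by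
  refine Finset.eq_empty_of_forall_notMem fun T hT => ?_
  obtain ⟨h, h', hd⟩ := mem_extensions.1 hT
  obtain ⟨Y, hY, hYS⟩ := Finset.exists_mem_notMem_of_card_lt_card
    (show S.interior.card < T.interior.card by omega)
  obtain ⟨u, L, -, hL, hLT⟩ := exists_suffix_mem_leaves hY hYS
  exact Finset.disjoint_left.1 hd (hP hL) hLT

/-- Together with `extensions_filter_mem`, this splits the extensions of S according to whether the
leaf L is expanded; these are the two branches of `explorationCount`. -/
theorem extensions_filter_notMem [DecidableEq X] [Finite X] (S : FullTree X)
    (P : Finset (List X)) (k : ℕ) (L : List X) :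
    ((S.extensions P k).filter fun T => L ∉ T.interior) = S.extensions (insert L P) k := by
  ext T
  rw [Finset.mem_filter, mem_extensions, mem_extensions, Finset.disjoint_insert_left]
  tauto

theorem extensions_filter_mem [DecidableEq X] [Fintype X] [Nonempty X] {S : FullTree X}
    (P : Finset (List X)) (k : ℕ) {L : List X} (hL : L ∈ S.leaves) :
    ((S.extensions P (k + 1)).filter fun T => L ∈ T.interior) =
      (S.grow L (mem_leaves.1 hL).1).extensions P k := by
  have hg : (S.grow L (mem_leaves.1 hL).1).interior = insert L S.interior := by
    ext w
    rw [mem_interior_grow, Finset.mem_insert]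
  ext T
  rw [Finset.mem_filter, mem_extensions, mem_extensions, hg,
    Finset.card_insert_of_notMem (mem_leaves.1 hL).2, Finset.insert_subset_iff, add_right_comm,
    ← add_assoc]
  tauto

variable [LinearOrder X]

open Classical in
-- An interior vertex of T outside S descends from (or is) a leaf of S that is neither in P nor
-- equal to L, so it is larger than L by minimality. The weight of L is therefore known before the
-- rest of T is explored.
theorem filter_interior_wordLT {B S T : FullTree X} {P : Finset (List X)} {L : List X}
    (hS : S.interior ⊆ T.interior) (hP : Disjoint P T.interior) (hL : L ∉ T.interior)
    (hmin : ∀ L' ∈ S.leaves \ P, L' ≠ L → wordLT L L')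
    (hlt : ∀ Y ∈ S.interior \ B.interior, wordLT Y L) :
    ((T.interior \ B.interior).filter fun Y => wordLT Y L) = S.interior \ B.interior := by
  ext Y
  rw [Finset.mem_filter, Finset.mem_sdiff, Finset.mem_sdiff]
  constructor
  · rintro ⟨⟨hYT, hYB⟩, hYL⟩
    refine ⟨by_contra fun hYS => ?_, hYB⟩
    obtain ⟨u, L', rfl, hL', hLT⟩ := exists_suffix_mem_leaves hYT hYS
    refine not_wordLT_of_wordLT hYL (wordLT_append (hmin L' (Finset.mem_sdiff.2 ⟨hL', ?_⟩) ?_) u)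
    · exact fun h => Finset.disjoint_left.1 hP h hLT
    · rintro rfl
      exact hL hLT
  · rintro ⟨hYS, hYB⟩
    exact ⟨⟨hS hYS, hYB⟩, hlt Y (Finset.mem_sdiff.2 ⟨hYS, hYB⟩)⟩

open Classical in
-- The set P holds the leaves already declared unexpanded; the other leaves of S are pending, and
-- the smallest one is decided next. The invariant `hlt`, that new interior vertices precede all
-- pending leaves, survives an expansion of L because L precedes its children and the other pending
-- leaves.
theorem sum_extensions [Fintype X] [Nonempty X] (q : ℕ) (B : FullTree X) (k r : ℕ)
    (S : FullTree X) (P : Finset (List X)) (hBS : B.interior ⊆ S.interior) (hP : P ⊆ S.leaves)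
    (hlt : ∀ Y ∈ S.interior \ B.interior, ∀ L ∈ S.leaves \ P, wordLT Y L)
    (hr : (S.leaves \ P).card = r) :
    ∑ T ∈ S.extensions P k,
      (q : ℤ) ^ ∑ L ∈ T.leaves \ P,
        ((T.interior \ B.interior).filter fun Y => wordLT Y L).card =
      explorationCount q (Fintype.card X) (S.interior \ B.interior).card r k := by
  induction k generalizing r S P with
  | zero =>
    rw [extensions_zero hP, Finset.sum_singleton, explorationCount.apply_zero]
    congr 1
    rw [Finset.sum_congr rfl fun L hL => by
      rw [Finset.filter_true_of_mem fun Y hY => hlt Y hY L hL], Finset.sum_const, hr, smul_eq_mul,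
      mul_comm]
  | succ k ihk =>
    induction r generalizing P with
    | zero =>
      have h : S.leaves ⊆ P := Finset.sdiff_eq_empty_iff_subset.1 (Finset.card_eq_zero.1 hr)
      rw [extensions_succ_of_leaves_subset h, Finset.sum_empty, explorationCount.zero_succ]
    | succ r ihr =>
      obtain ⟨L, hLm, hmin⟩ := exists_wordLT_min (P := S.leaves \ P)
        (Finset.card_pos.1 (by omega))
      obtain ⟨hL, hLP⟩ := Finset.mem_sdiff.1 hLm
      rw [← Finset.sum_filter_add_sum_filter_not _ (fun T => L ∈ T.interior),
        extensions_filter_mem P k hL, extensions_filter_notMem, add_comm,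
        explorationCount.succ_succ]
      congr 1
      · have hsd : S.leaves \ insert L P = (S.leaves \ P).erase L := by
          ext w
          simp only [Finset.mem_sdiff, Finset.mem_insert, Finset.mem_erase]
          tauto
        rw [← ihr (insert L P) (Finset.insert_subset hL hP)
          (fun Y hY L' hL' => hlt Y hY L' (Finset.mem_of_mem_erase (hsd ▸ hL')))
          (by rw [hsd, Finset.card_erase_of_mem hLm, hr, Nat.add_sub_cancel]), Finset.mul_sum]
        refine Finset.sum_congr rfl fun T hT => ?_
        obtain ⟨-, hST, hd⟩ := mem_extensions.1 hT
        obtain ⟨hLT, hPT⟩ := Finset.disjoint_insert_left.1 hd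
        have hl : T.leaves \ P = insert L (T.leaves \ insert L P) := by
          have : L ∈ T.leaves := mem_leaves.2
            ⟨verts_subset_of_interior_subset hST (mem_leaves.1 hL).1, hLT⟩
          ext w
          simp only [Finset.mem_sdiff, Finset.mem_insert]
          by_cases hw : w = L
          · simp [hw, this, hLP]
          · simp [hw]
        rw [hl, Finset.sum_insert (by simp), pow_add, filter_interior_wordLT hST hPT hLT hmin
          fun Y hY => hlt Y hY L hLm]
      · have hg : (S.grow L (mem_leaves.1 hL).1).interior = insert L S.interior := by
          ext w
          rw [mem_interior_grow, Finset.mem_insert]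
        have hLB : L ∉ B.interior := fun h => (mem_leaves.1 hL).2 (hBS h)
        have hcard : (insert L S.interior \ B.interior).card =
            (S.interior \ B.interior).card + 1 := by
          rw [Finset.insert_sdiff_of_notMem _ hLB, Finset.card_insert_of_notMem]
          exact fun h => (mem_leaves.1 hL).2 (Finset.mem_sdiff.1 h).1
        have hch : ∀ x, x :: L ∉ S.leaves := fun x h =>
          (mem_leaves.1 hL).2 (cons_mem_verts.1 (mem_leaves.1 h).1)
        have hlv : (S.grow L (mem_leaves.1 hL).1).leaves \ P =
            (S.leaves \ P).erase L ∪ Finset.univ.image (· :: L) := by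
          ext w
          simp only [Finset.mem_sdiff, mem_leaves_grow hL, Finset.mem_union, Finset.mem_erase,
            Finset.mem_image, Finset.mem_univ, true_and]
          constructor
          · tauto
          · rintro (h | ⟨x, rfl⟩)
            · tauto
            · exact ⟨Or.inr ⟨x, rfl⟩, fun h => hch x (hP h)⟩
        rw [← hcard, ← hg]
        refine ihk (r + Fintype.card X) (S.grow L (mem_leaves.1 hL).1) P ?_ ?_ ?_ ?_
        · rw [hg]
          exact hBS.trans (Finset.subset_insert _ _)
        · intro w hw
          exact (mem_leaves_grow hL).2 (Or.inl ⟨hP hw, fun h => hLP (h ▸ hw)⟩)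
        · intro Y hY L' hL'
          have hYL : Y = L ∨ wordLT Y L := by
            rw [hg, Finset.mem_sdiff, Finset.mem_insert] at hY
            obtain ⟨h | h, h'⟩ := hY
            · exact Or.inl h
            · exact Or.inr (hlt Y (Finset.mem_sdiff.2 ⟨h, h'⟩) L hLm)
          have hLL : wordLT L L' := by
            rw [hlv, Finset.mem_union, Finset.mem_erase, Finset.mem_image] at hL'
            rcases hL' with ⟨h, h'⟩ | ⟨x, -, rfl⟩
            · exact hmin L' h' h
            · exact wordLT_cons x L
          rcases hYL with rfl | h
          · exact hLL
          · exact wordLT_trans h hLL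
        · rw [hlv, Finset.card_union_of_disjoint, Finset.card_erase_of_mem hLm, hr,
            Finset.card_image_of_injective _ (fun x y h => by simpa using h), Finset.card_univ,
            Nat.add_sub_cancel]
          refine Finset.disjoint_left.2 fun w hw hw' => ?_
          obtain ⟨x, -, rfl⟩ := Finset.mem_image.1 hw'
          exact hch x (Finset.mem_sdiff.1 (Finset.mem_of_mem_erase hw)).1

open Classical in
theorem sum_pow_countBelow [Fintype X] [Nonempty X] (q : ℕ) (B : FullTree X) (k : ℕ) :
    ∑ T ∈ (treesWithCard X (B.interior.card + k)).filter fun T => B.interior ⊆ T.interior,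
      (q : ℤ) ^ T.countBelow (T.interior \ B.interior) =
      explorationCount q (Fintype.card X) 0
        (Fintype.card X * B.interior.card + 1 - B.interior.card) k := by
  have h := sum_extensions q B k B.leaves.card B ∅ subset_rfl (Finset.empty_subset _)
    (by simp) (by simp)
  have hl := B.card_leaves_add_card_interior
  rw [show Fintype.card X * B.interior.card + 1 - B.interior.card = B.leaves.card by omega]
  simpa [extensions, countBelow] using h

theorem F_eval_add_sum [Finite X] (T : FullTree X) (q : ℤ)
    [Fintype {S : FullTree X // S.interior ⊂ T.interior}] :
    (F T).eval q + ∑ S : {S : FullTree X // S.interior ⊂ T.interior},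
      (F S.1).eval q * q ^ T.countBelow (T.interior \ S.1.interior) =
      q ^ (T.verts.card - 1) * q ^ T.countBelow T.interior := by
  have h := congrArg (Polynomial.eval q) (F.eq_1 T)
  simp only [Polynomial.eval_sub, Polynomial.eval_mul, Polynomial.eval_pow, Polynomial.eval_X,
    Polynomial.eval_finsetSum] at h
  rw [h]
  convert sub_add_cancel _ _

open Classical in
-- This is the definition of F_T with the subtracted sum moved to the other side: the term S = T is
-- F_T itself, and the smaller trees are sorted by their number of interior vertices.
theorem sum_F_eval_mul [Fintype X] (T : FullTree X) (q : ℤ) :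
    ∑ j ∈ Finset.range (T.interior.card + 1),
      ∑ S ∈ (treesWithCard X j).filter fun S => S.interior ⊆ T.interior,
        (F S).eval q * q ^ T.countBelow (T.interior \ S.interior) =
      q ^ (Fintype.card X * T.interior.card) * q ^ T.countBelow T.interior := by
  have : Fintype {S : FullTree X // S.interior ⊂ T.interior} := Fintype.ofFinite _
  have h := F_eval_add_sum T q
  rw [card_verts, Nat.add_sub_cancel] at h
  rw [← h, Finset.sum_range_succ, add_comm]
  congr 1
  · rw [Finset.sum_eq_single_of_mem T]
    · simp [countBelow]
    · simp [mem_treesWithCard]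
    · intro S hS hne
      obtain ⟨h, h'⟩ := Finset.mem_filter.1 hS
      exact absurd (interior_injective (Finset.eq_of_subset_of_card_le h'
        (mem_treesWithCard.1 h).ge)) hne
  · rw [← Finset.sum_biUnion]
    · refine Finset.sum_subtype _ (p := fun S => S.interior ⊂ T.interior) (fun S => ?_)
        (fun S : FullTree X => (F S).eval q * q ^ T.countBelow (T.interior \ S.interior))
      simp only [Finset.mem_biUnion, Finset.mem_range, Finset.mem_filter, mem_treesWithCard]
      constructor
      · rintro ⟨j, hj, rfl, hS⟩
        exact Finset.ssubset_iff_subset_ne.2 ⟨hS, fun h => hj.ne (congrArg Finset.card h)⟩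
      · exact fun hS => ⟨_, Finset.card_lt_card hS, rfl, hS.1⟩
    · intro i _ j _ hij
      refine Finset.disjoint_left.2 fun S hS hS' => hij ?_
      rw [← mem_treesWithCard.1 (Finset.mem_filter.1 hS).1,
        ← mem_treesWithCard.1 (Finset.mem_filter.1 hS').1]

theorem Fsum_eval [Finite X] (n : ℕ) (q : ℤ) :
    (Fsum X n).eval q = ∑ T ∈ treesWithCard X n, (F T).eval q := by
  rw [Fsum, Polynomial.eval_finsetSum]
  exact (Finset.sum_subtype _ (fun T => mem_treesWithCard)
    (fun T : FullTree X => (F T).eval q)).symm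

/-- The recursion that determines the values of the polynomials `F_n`. -/
theorem sum_Fsum_eval_mul [Fintype X] [Nonempty X] (q n : ℕ) :
    ∑ j ∈ Finset.range (n + 1), (Fsum X j).eval (q : ℤ) *
      explorationCount q (Fintype.card X) 0 (Fintype.card X * j + 1 - j) (n - j) =
      (q : ℤ) ^ (Fintype.card X * n) * explorationCount q (Fintype.card X) 0 1 n := by
  classical
  have hB := sum_pow_countBelow q (trivial X) n
  simp only [interior_trivial, Finset.card_empty, zero_add, Finset.empty_subset,
    Finset.filter_true, Finset.sdiff_empty, mul_zero, Nat.sub_zero] at hB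
  rw [← hB, Finset.mul_sum]
  have h : ∀ T ∈ treesWithCard X n,
      (q : ℤ) ^ (Fintype.card X * n) * (q : ℤ) ^ T.countBelow T.interior =
      ∑ j ∈ Finset.range (n + 1), ∑ S ∈ treesWithCard X j, if S.interior ⊆ T.interior then
        (F S).eval (q : ℤ) * (q : ℤ) ^ T.countBelow (T.interior \ S.interior) else 0 := by
    intro T hT
    have h := sum_F_eval_mul T (q : ℤ)
    rw [mem_treesWithCard.1 hT] at h
    rw [← h]
    simp only [Finset.sum_filter]
  rw [Finset.sum_congr rfl h, Finset.sum_comm]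
  refine Finset.sum_congr rfl fun j hj => ?_
  rw [Finset.sum_comm, Fsum_eval, Finset.sum_mul]
  refine Finset.sum_congr rfl fun S hS => ?_
  have hS' := mem_treesWithCard.1 hS
  have hk := sum_pow_countBelow q S (n - j)
  rw [hS', Nat.add_sub_cancel' (Nat.lt_succ_iff.1 (Finset.mem_range.1 hj))] at hk
  rw [← hk, Finset.sum_filter, Finset.mul_sum]
  refine Finset.sum_congr rfl fun T _ => ?_
  split_ifs <;> simp

end Sum

end FullTree

/-! ### Counting linear maps over a finite field -/

namespace FiniteField

open Module

variable {K U W : Type*} [Field K] [Fintype K] [AddCommGroup U] [Module K U] [AddCommGroup W]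
  [Module K W] [FiniteDimensional K W]

theorem finite_linearMap [FiniteDimensional K U] : Finite (U →ₗ[K] W) :=
  Module.finite_of_finite K

theorem card_linearMap [FiniteDimensional K U] :
    Nat.card (U →ₗ[K] W) = Fintype.card K ^ (finrank K U * finrank K W) := by
  rw [Module.natCard_eq_pow_finrank (K := K), Nat.card_eq_fintype_card, finrank_linearMap]

/-- The extensions of g form a torsor under the linear maps that vanish on S. -/
theorem card_linearMap_extending (S : Submodule K U) [FiniteDimensional K (U ⧸ S)]
    (g : S →ₗ[K] W) : Nat.card {φ : U →ₗ[K] W // φ ∘ₗ S.subtype = g} =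
      Fintype.card K ^ (finrank K (U ⧸ S) * finrank K W) := by
  obtain ⟨g', hg'⟩ := g.exists_extend
  rw [← card_linearMap]
  symm
  refine Nat.card_congr (Equiv.ofBijective (fun c : (U ⧸ S) →ₗ[K] W =>
    (⟨g' + c ∘ₗ S.mkQ, ?_⟩ : {φ : U →ₗ[K] W // φ ∘ₗ S.subtype = g})) ⟨?_, ?_⟩)
  · refine LinearMap.ext fun s => ?_
    simp [← hg', (Submodule.Quotient.mk_eq_zero S).2 s.2]
  · intro c c' h
    exact S.linearMap_qext (add_left_cancel (Subtype.ext_iff.1 h))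
  · rintro ⟨φ, hφ⟩
    refine ⟨S.liftQ (φ - g') fun s hs => ?_, Subtype.ext (LinearMap.ext fun u => ?_)⟩
    · have h := LinearMap.congr_fun (hφ.trans hg'.symm) ⟨s, hs⟩
      simpa [sub_eq_zero] using h
    · simp

theorem card_injective_linearMap [FiniteDimensional K U] (h : finrank K U ≤ finrank K W) :
    Nat.card {g : U →ₗ[K] W // Function.Injective g} =
      ∏ i : Fin (finrank K U), (Fintype.card K ^ finrank K W - Fintype.card K ^ (i : ℕ)) := by
  have : Finite W := Module.finite_of_finite K
  rw [← card_linearIndependent h]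
  let b := finBasis K U
  refine Nat.card_congr (Equiv.subtypeEquiv (b.constr ℕ).symm.toEquiv fun g => ?_)
  change _ ↔ LinearIndependent K fun i => g (b i)
  have hg : ⇑g = Finsupp.linearCombination K (fun i => g (b i)) ∘ b.repr := by
    ext u
    conv_lhs => rw [← b.linearCombination_repr u]
    rw [Finsupp.apply_linearCombination]
    rfl
  change Function.Injective g ↔
    Function.Injective (Finsupp.linearCombination K fun i => g (b i))
  conv_lhs => rw [hg]
  exact Function.Injective.of_comp_iff' _ b.repr.bijective

theorem card_linearMap_injOn [FiniteDimensional K U] (J : Submodule K U)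
    (h : finrank K J ≤ finrank K W) :
    Nat.card {φ : U →ₗ[K] W // Function.Injective (φ ∘ₗ J.subtype)} =
      (∏ i : Fin (finrank K J), (Fintype.card K ^ finrank K W - Fintype.card K ^ (i : ℕ))) *
        Fintype.card K ^ (finrank K (U ⧸ J) * finrank K W) := by
  have h1 : Finite (U →ₗ[K] W) := finite_linearMap
  have h2 : Finite (J →ₗ[K] W) := finite_linearMap
  have := Fintype.ofFinite {g : J →ₗ[K] W // Function.Injective g}
  let e : {φ : U →ₗ[K] W // Function.Injective (φ ∘ₗ J.subtype)} ≃
      Σ g : {g : J →ₗ[K] W // Function.Injective g}, {φ : U →ₗ[K] W // φ ∘ₗ J.subtype = g.1} :=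
    { toFun := fun φ => ⟨⟨φ.1 ∘ₗ J.subtype, φ.2⟩, φ.1, rfl⟩
      invFun := fun p => ⟨p.2.1, by rw [p.2.2]; exact p.1.2⟩
      left_inv := fun φ => rfl
      right_inv := by
        rintro ⟨⟨g, hg⟩, φ, h⟩
        obtain rfl : φ ∘ₗ J.subtype = g := h
        rfl }
  rw [Nat.card_congr e, Nat.card_sigma, Finset.sum_congr rfl fun g _ =>
    card_linearMap_extending J g.1, Finset.sum_const, Finset.card_univ, ← Nat.card_eq_fintype_card,
    card_injective_linearMap h, smul_eq_mul]

end FiniteField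

/-! ### Counting left ideals of the free algebra -/

namespace NCSeries

open Module

variable {K X : Type*} [Field K]

/-- The left multiplication by the letter `x` on the free algebra with basis the words. -/
noncomputable def letterMul (K : Type*) {X : Type*} [Field K] (x : X) :
    (List X →₀ K) →ₗ[K] (List X →₀ K) :=
  Finsupp.lmapDomain K K (List.cons x)

theorem letterMul_single (x : X) (w : List X) (a : K) :
    letterMul K x (Finsupp.single w a) = Finsupp.single (x :: w) a := by
  simp [letterMul]

/-- The left ideals of the free algebra. -/
def IsLeftIdeal (I : Submodule K (List X →₀ K)) : Prop :=
  ∀ x, ∀ v ∈ I, letterMul K x v ∈ I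

/-- The set of all left ideals of codimension `n` that are contained in `I`. -/
def subideals (I : Submodule K (List X →₀ K)) (n : ℕ) : Set (Submodule K (List X →₀ K)) :=
  {L | IsLeftIdeal L ∧ L ≤ I ∧ FiniteDimensional K ((List X →₀ K) ⧸ L) ∧
    finrank K ((List X →₀ K) ⧸ L) = n}

variable {W : Type*} [AddCommGroup W] [Module K W]

/-- The pairs of a representation `D` of the free algebra on `W` and of a linear map to `W` that is
equivariant on `I`. -/
def EquivariantPairs (I : Submodule K (List X →₀ K)) (W : Type*) [AddCommGroup W] [Module K W] :
    Type _ :=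
  {p : (X → W →ₗ[K] W) × ((List X →₀ K) →ₗ[K] W) //
    ∀ x, ∀ v ∈ I, p.2 (letterMul K x v) = p.1 x (p.2 v)}

theorem ext_of_letterMul {φ ψ : (List X →₀ K) →ₗ[K] W}
    (h0 : φ (Finsupp.single [] 1) = ψ (Finsupp.single [] 1))
    (h : ∀ x w, φ (Finsupp.single w 1) = ψ (Finsupp.single w 1) →
      φ (Finsupp.single (x :: w) 1) = ψ (Finsupp.single (x :: w) 1)) : φ = ψ := by
  refine Finsupp.lhom_ext' fun w => LinearMap.ext_ring ?_
  change φ (Finsupp.single w 1) = ψ (Finsupp.single w 1)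
  induction w with
  | nil => exact h0
  | cons x w ih => exact h x w ih

/-- The parametrization of `EquivariantPairs`. -/
noncomputable def equivariantPairsMap (I : Submodule K (List X →₀ K)) (p : EquivariantPairs I W) :
    (X → W →ₗ[K] W) × W × (X → ((List X →₀ K) ⧸ I) →ₗ[K] W) :=
  (p.1.1, p.1.2 (Finsupp.single [] 1), fun x =>
    I.liftQ (p.1.2 ∘ₗ letterMul K x - p.1.1 x ∘ₗ p.1.2) fun v hv => by
      simpa [sub_eq_zero] using p.2 x v hv)

/-- The defect φ(xv) - D_x φ(v) depends only on v modulo I and is otherwise arbitrary: from φ(∅), D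
and c, the rule φ(xw) = D_x φ(w) + c_x(w) recovers φ by recursion on words. -/
theorem equivariantPairsMap_bijective (I : Submodule K (List X →₀ K)) :
    Function.Bijective (equivariantPairsMap (W := W) I) := by
  constructor
  · rintro ⟨⟨D, φ⟩, hp⟩ ⟨⟨D', φ'⟩, hp'⟩ h
    simp only [equivariantPairsMap, Prod.mk.injEq] at h
    obtain ⟨rfl, h0, h⟩ := h
    refine Subtype.ext (Prod.ext rfl (ext_of_letterMul h0 fun x w hw => ?_))
    have h' := LinearMap.congr_fun (congrFun h x) (I.mkQ (Finsupp.single w 1))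
    simp only [Submodule.mkQ_apply, Submodule.liftQ_apply, LinearMap.sub_apply,
      LinearMap.comp_apply, letterMul_single] at h'
    rw [hw] at h'
    exact sub_left_injective h'
  · rintro ⟨D, w₀, c⟩
    let val : List X → W := fun w =>
      List.rec w₀ (fun x w y => D x y + c x (I.mkQ (Finsupp.single w 1))) w
    let φ : (List X →₀ K) →ₗ[K] W := Finsupp.linearCombination K val
    have hφ : ∀ w, φ (Finsupp.single w 1) = val w := fun w => by
      simp [φ, Finsupp.linearCombination_single]
    have key : ∀ x, φ ∘ₗ letterMul K x = D x ∘ₗ φ + c x ∘ₗ I.mkQ := by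
      intro x
      refine Finsupp.lhom_ext' fun w => LinearMap.ext_ring ?_
      change φ (letterMul K x (Finsupp.single w 1)) =
        D x (φ (Finsupp.single w 1)) + c x (I.mkQ (Finsupp.single w 1))
      rw [letterMul_single, hφ, hφ]
    refine ⟨⟨(D, φ), fun x v hv => ?_⟩, ?_⟩
    · have h := LinearMap.congr_fun (key x) v
      simp only [LinearMap.comp_apply, LinearMap.add_apply, Submodule.mkQ_apply,
        (Submodule.Quotient.mk_eq_zero I).2 hv, map_zero, add_zero] at h
      exact h
    · refine Prod.ext rfl (Prod.ext (hφ []) (funext fun x => I.linearMap_qext ?_))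
      simp only [equivariantPairsMap]
      rw [Submodule.liftQ_mkQ, key, add_sub_cancel_left]

/-- The pairs of a representation `D` of the free algebra on `W` and of a linear map to `W` that is
equivariant on `I` and whose kernel meets `I` in `L`. -/
def EquivariantPairsWithKer (I L : Submodule K (List X →₀ K)) (W : Type*) [AddCommGroup W]
    [Module K W] : Type _ :=
  {p : EquivariantPairs I W // I ⊓ LinearMap.ker p.1.2 = L}

theorem injective_comp_subtype_map_mkQ_iff {I L : Submodule K (List X →₀ K)}
    (φ : ((List X →₀ K) ⧸ L) →ₗ[K] W) :
    Function.Injective (φ ∘ₗ (I.map L.mkQ).subtype) ↔ I ⊓ LinearMap.ker (φ ∘ₗ L.mkQ) ≤ L := by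
  rw [← LinearMap.ker_eq_bot, LinearMap.ker_eq_bot']
  constructor
  · rintro h v ⟨hv, hv'⟩
    have h' := h ⟨L.mkQ v, v, hv, rfl⟩ hv'
    exact (Submodule.Quotient.mk_eq_zero L).1 (congrArg Subtype.val h')
  · rintro h ⟨_, v, hv, rfl⟩ hv'
    exact Subtype.ext ((Submodule.Quotient.mk_eq_zero L).2 (h ⟨hv, hv'⟩))

/-- The equivariant pair with given kernel that is defined by a linear map on the quotient and by
compatible endomorphisms. -/
noncomputable def equivariantPairsWithKerMap {I L : Submodule K (List X →₀ K)} (hLI : L ≤ I)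
    (s : Σ φ : {φ : ((List X →₀ K) ⧸ L) →ₗ[K] W //
        Function.Injective (φ ∘ₗ (I.map L.mkQ).subtype)},
      ∀ x, {D : W →ₗ[K] W // ∀ v ∈ I, φ.1 (L.mkQ (letterMul K x v)) = D (φ.1 (L.mkQ v))}) :
    EquivariantPairsWithKer I L W :=
  ⟨⟨(fun x => (s.2 x).1, s.1.1 ∘ₗ L.mkQ), fun x v hv => (s.2 x).2 v hv⟩, by
    refine le_antisymm ((injective_comp_subtype_map_mkQ_iff s.1.1).1 s.1.2) (le_inf hLI ?_)
    intro v hv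
    change s.1.1 (L.mkQ v) = 0
    rw [Submodule.mkQ_apply, (Submodule.Quotient.mk_eq_zero L).2 hv, map_zero]⟩

/-- A map whose kernel meets I in L factors through the quotient by L and is injective on I/L; given
the map, the endomorphisms D_x are constrained independently of each other. -/
theorem equivariantPairsWithKerMap_bijective {I L : Submodule K (List X →₀ K)} (hLI : L ≤ I) :
    Function.Bijective (equivariantPairsWithKerMap (W := W) hLI) := by
  constructor
  · rintro ⟨⟨φ, hφ⟩, D⟩ ⟨⟨φ', hφ'⟩, D'⟩ h
    have h' := Prod.ext_iff.1 (Subtype.ext_iff.1 (Subtype.ext_iff.1 h))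
    obtain rfl : φ = φ' := L.linearMap_qext h'.2
    obtain rfl : D = D' := funext fun x => Subtype.ext (congrFun h'.1 x)
    rfl
  · intro p
    refine ⟨⟨⟨L.liftQ p.1.1.2 (p.2.symm.le.trans inf_le_right), ?_⟩,
      fun x => ⟨p.1.1.1 x, fun v hv => p.1.2 x v hv⟩⟩,
      Subtype.ext (Subtype.ext (Prod.ext rfl (Submodule.liftQ_mkQ L _ _)))⟩
    rw [injective_comp_subtype_map_mkQ_iff, Submodule.liftQ_mkQ]
    exact p.2.le

/-- The number of elements of `EquivariantPairsWithKer I L W` if `W` has dimension `N`, the left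
ideal `I` has codimension `n` and `L` has codimension `n + j`. -/
def equivariantPairsWithKerCard (q m N n j : ℕ) : ℕ :=
  (∏ i : Fin j, (q ^ N - q ^ (i : ℕ))) * q ^ (n * N) * (q ^ ((N - j) * N)) ^ m

/-- Equivariance makes the intersection a left ideal. Its codimension is bounded because it is the
kernel of v ↦ (v mod I, φ(v)). -/
theorem inf_ker_mem_subideals {I : Submodule K (List X →₀ K)} (hI : IsLeftIdeal I)
    [FiniteDimensional K W]
    [FiniteDimensional K ((List X →₀ K) ⧸ I)] (p : EquivariantPairs I W) :
    ∃ j ≤ finrank K W, I ⊓ LinearMap.ker p.1.2 ∈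
      subideals I (finrank K ((List X →₀ K) ⧸ I) + j) := by
  have hker : LinearMap.ker (I.mkQ.prod p.1.2) = I ⊓ LinearMap.ker p.1.2 := by
    rw [LinearMap.ker_prod, Submodule.ker_mkQ]
  have e := (LinearMap.quotKerEquivRange (I.mkQ.prod p.1.2)).symm
  rw [hker] at e
  have hfin : FiniteDimensional K ((List X →₀ K) ⧸ (I ⊓ LinearMap.ker p.1.2)) :=
    e.finiteDimensional
  have hle : finrank K ((List X →₀ K) ⧸ (I ⊓ LinearMap.ker p.1.2)) ≤
      finrank K ((List X →₀ K) ⧸ I) + finrank K W := by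
    rw [← e.finrank_eq, ← finrank_prod]
    exact Submodule.finrank_le _
  have hge : finrank K ((List X →₀ K) ⧸ I) ≤
      finrank K ((List X →₀ K) ⧸ (I ⊓ LinearMap.ker p.1.2)) :=
    LinearMap.finrank_le_finrank_of_surjective (Submodule.factor_surjective inf_le_left)
  refine ⟨_, Nat.sub_le_of_le_add (by rwa [add_comm] at hle), fun x v hv => ⟨hI x v hv.1, ?_⟩,
    inf_le_left, hfin, (Nat.add_sub_cancel' hge).symm⟩
  exact (p.2 x v hv.1).trans ((congrArg (p.1.1 x) hv.2).trans (map_zero _))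

/-! ### Cardinalities over a finite field. -/

section Fintype

variable [Fintype K] [FiniteDimensional K W]

/-- Equivariance prescribes D exactly on φ(I/L). The prescription is consistent because φ is
injective on I/L and L is a left ideal. -/
theorem card_compatible_endomorphisms {I L : Submodule K (List X →₀ K)} (hL : IsLeftIdeal L)
    [FiniteDimensional K ((List X →₀ K) ⧸ L)] (φ : ((List X →₀ K) ⧸ L) →ₗ[K] W)
    (hφ : Function.Injective (φ ∘ₗ (I.map L.mkQ).subtype)) (x : X) :
    Nat.card {D : W →ₗ[K] W // ∀ v ∈ I, φ (L.mkQ (letterMul K x v)) = D (φ (L.mkQ v))} =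
      Fintype.card K ^ ((finrank K W - finrank K (I.map L.mkQ)) * finrank K W) := by
  obtain ⟨s, hs⟩ := (φ ∘ₗ (I.map L.mkQ).subtype).exists_leftInverse_of_injective
    (LinearMap.ker_eq_bot.2 hφ)
  let D₀ : W →ₗ[K] W :=
    φ ∘ₗ L.mapQ L (letterMul K x) (fun v hv => hL x v hv) ∘ₗ (I.map L.mkQ).subtype ∘ₗ s
  have hD₀ : ∀ v ∈ I, φ (L.mkQ (letterMul K x v)) = D₀ (φ (L.mkQ v)) := by
    intro v hv
    have h : s (φ (L.mkQ v)) = ⟨L.mkQ v, v, hv, rfl⟩ :=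
      LinearMap.congr_fun hs ⟨L.mkQ v, v, hv, rfl⟩
    simp only [D₀, LinearMap.comp_apply, h]
    rfl
  let R : Submodule K W := LinearMap.range (φ ∘ₗ (I.map L.mkQ).subtype)
  have hR : finrank K (W ⧸ R) = finrank K W - finrank K (I.map L.mkQ) := by
    rw [← LinearMap.finrank_range_of_inj hφ, ← Submodule.finrank_quotient_add_finrank R,
      Nat.add_sub_cancel]
  rw [← hR, ← FiniteField.card_linearMap_extending R (D₀ ∘ₗ R.subtype)]
  refine Nat.card_congr (Equiv.subtypeEquivRight fun D => ?_)
  constructor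
  · intro h
    refine LinearMap.ext ?_
    rintro ⟨_, ⟨_, v, hv, rfl⟩, rfl⟩
    exact (h v hv).symm.trans (hD₀ v hv)
  · intro h v hv
    exact (hD₀ v hv).trans
      (LinearMap.congr_fun h ⟨φ (L.mkQ v), ⟨L.mkQ v, v, hv, rfl⟩, rfl⟩).symm

variable [Fintype X]

theorem card_equivariantPairsWithKer {I L : Submodule K (List X →₀ K)} {n j : ℕ}
    (hI : finrank K ((List X →₀ K) ⧸ I) = n) (hL : L ∈ subideals I (n + j))
    (hj : j ≤ finrank K W) : Nat.card (EquivariantPairsWithKer I L W) =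
      equivariantPairsWithKerCard (Fintype.card K) (Fintype.card X) (finrank K W) n j := by
  obtain ⟨hL, hLI, hfin, hdim⟩ := hL
  have hn : finrank K (((List X →₀ K) ⧸ L) ⧸ I.map L.mkQ) = n := by
    rw [← hI]
    exact (Submodule.quotientQuotientEquivQuotient L I hLI).finrank_eq
  have hJ : finrank K (I.map L.mkQ) = j := by
    have h := (I.map L.mkQ).finrank_quotient_add_finrank
    omega
  have h1 : Finite (((List X →₀ K) ⧸ L) →ₗ[K] W) := FiniteField.finite_linearMap
  have h2 : Finite (W →ₗ[K] W) := FiniteField.finite_linearMap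
  have := Fintype.ofFinite {φ : ((List X →₀ K) ⧸ L) →ₗ[K] W //
    Function.Injective (φ ∘ₗ (I.map L.mkQ).subtype)}
  rw [← Nat.card_eq_of_bijective _ (equivariantPairsWithKerMap_bijective (W := W) hLI),
    Nat.card_sigma, Finset.sum_congr rfl fun φ _ => by
      rw [Nat.card_pi, Finset.prod_congr rfl fun x _ =>
        card_compatible_endomorphisms hL φ.1 φ.2 x, Finset.prod_const, Finset.card_univ],
    Finset.sum_const, Finset.card_univ, ← Nat.card_eq_fintype_card,
    FiniteField.card_linearMap_injOn _ (by omega), smul_eq_mul, hn, hJ,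
    equivariantPairsWithKerCard]

theorem card_equivariantPairs (I : Submodule K (List X →₀ K))
    [FiniteDimensional K ((List X →₀ K) ⧸ I)] :
    Nat.card (EquivariantPairs I W) =
      (Fintype.card K ^ (finrank K W * finrank K W)) ^ Fintype.card X *
        (Fintype.card K ^ finrank K W *
        (Fintype.card K ^ (finrank K ((List X →₀ K) ⧸ I) * finrank K W)) ^ Fintype.card X) := by
  rw [Nat.card_eq_of_bijective _ (equivariantPairsMap_bijective I), Nat.card_prod, Nat.card_prod,
    Nat.card_fun, Nat.card_fun, FiniteField.card_linearMap, FiniteField.card_linearMap,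
    Module.natCard_eq_pow_finrank (K := K) (V := W), Nat.card_eq_fintype_card,
    Nat.card_eq_fintype_card]

theorem finite_equivariantPairs (I : Submodule K (List X →₀ K))
    [FiniteDimensional K ((List X →₀ K) ⧸ I)] : Finite (EquivariantPairs I W) := by
  have h1 : Finite (((List X →₀ K) ⧸ I) →ₗ[K] W) := FiniteField.finite_linearMap
  have h2 : Finite (W →ₗ[K] W) := FiniteField.finite_linearMap
  have h3 : Finite W := Module.finite_of_finite K
  exact Finite.of_injective _ (equivariantPairsMap_bijective I).1

theorem equivariantPairsWithKerCard_pos {q m N n j : ℕ} (hq : 1 < q) (hj : j ≤ N) :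
    0 < equivariantPairsWithKerCard q m N n j := by
  have hprod : 0 < ∏ i : Fin j, (q ^ N - q ^ (i : ℕ)) := Finset.prod_pos fun i _ =>
    Nat.sub_pos_of_lt (Nat.pow_lt_pow_right hq (i.2.trans_le hj))
  have hq0 : 0 < q := by omega
  unfold equivariantPairsWithKerCard
  positivity

/-- Each such L comes from an equivariant pair, since its fibre has positive cardinality, and there
are only finitely many pairs. -/
theorem finite_subideals_of_le (W : Type*) [AddCommGroup W] [Module K W] [FiniteDimensional K W]
    {I : Submodule K (List X →₀ K)} [FiniteDimensional K ((List X →₀ K) ⧸ I)] :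
    {L | ∃ j ≤ finrank K W,
      L ∈ subideals I (finrank K ((List X →₀ K) ⧸ I) + j)}.Finite := by
  have := finite_equivariantPairs (W := W) I
  refine (Set.finite_range fun p : EquivariantPairs I W => I ⊓ LinearMap.ker p.1.2).subset ?_
  rintro L ⟨j, hj, hL⟩
  have h := equivariantPairsWithKerCard_pos (m := Fintype.card X)
    (n := finrank K ((List X →₀ K) ⧸ I)) (Fintype.one_lt_card (α := K)) hj
  rw [← card_equivariantPairsWithKer rfl hL hj] at h
  obtain ⟨p, hp⟩ := (Nat.card_pos_iff.1 h).1
  exact ⟨p, hp⟩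

theorem finite_subideals {I : Submodule K (List X →₀ K)}
    [FiniteDimensional K ((List X →₀ K) ⧸ I)] (j : ℕ) :
    (subideals I (finrank K ((List X →₀ K) ⧸ I) + j)).Finite :=
  (finite_subideals_of_le (Fin j → K)).subset fun _ hL =>
    ⟨j, (finrank_fin_fun K).ge, hL⟩

theorem card_equivariantPairs_eq_sum {I : Submodule K (List X →₀ K)} (hI : IsLeftIdeal I)
    [FiniteDimensional K ((List X →₀ K) ⧸ I)] :
    Nat.card (EquivariantPairs I W) = ∑ j ∈ Finset.range (finrank K W + 1),
      (subideals I (finrank K ((List X →₀ K) ⧸ I) + j)).ncard *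
        equivariantPairsWithKerCard (Fintype.card K) (Fintype.card X) (finrank K W)
          (finrank K ((List X →₀ K) ⧸ I)) j := by
  classical
  set n := finrank K ((List X →₀ K) ⧸ I) with hn
  have hfin := finite_subideals_of_le (I := I) W
  rw [← hn] at hfin
  have := finite_equivariantPairs (W := W) I
  let f : EquivariantPairs I W → hfin.toFinset := fun p =>
    ⟨I ⊓ LinearMap.ker p.1.2, hfin.mem_toFinset.2 (inf_ker_mem_subideals hI p)⟩
  have hcard : ∀ L : hfin.toFinset, Nat.card {p // f p = L} =
      equivariantPairsWithKerCard (Fintype.card K) (Fintype.card X) (finrank K W) n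
        (finrank K ((List X →₀ K) ⧸ L.1) - n) := by
    rintro ⟨L, hL⟩
    obtain ⟨j, hj, hLj⟩ := hfin.mem_toFinset.1 hL
    rw [show finrank K ((List X →₀ K) ⧸ L) - n = j by rw [hLj.2.2.2, Nat.add_sub_cancel_left],
      ← card_equivariantPairsWithKer hn.symm hLj hj]
    exact Nat.card_congr (Equiv.subtypeEquivRight fun p => Subtype.ext_iff)
  have hsum := Finset.sum_coe_sort hfin.toFinset fun L =>
    equivariantPairsWithKerCard (Fintype.card K) (Fintype.card X) (finrank K W) n
      (finrank K ((List X →₀ K) ⧸ L) - n)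
  rw [← Nat.card_congr (Equiv.sigmaFiberEquiv f), Nat.card_sigma,
    Finset.sum_congr rfl fun L _ => hcard L, hsum,
    ← Finset.sum_fiberwise_of_maps_to (t := Finset.range (finrank K W + 1))
      (g := fun L => finrank K ((List X →₀ K) ⧸ L) - n)]
  · refine Finset.sum_congr rfl fun j hj => ?_
    rw [Finset.sum_congr rfl fun L hL => by rw [(Finset.mem_filter.1 hL).2], Finset.sum_const,
      smul_eq_mul, Set.ncard_eq_toFinset_card _ (finite_subideals j)]
    congr 2
    ext L
    rw [Finset.mem_filter, Set.Finite.mem_toFinset, Set.Finite.mem_toFinset]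
    constructor
    · rintro ⟨⟨i, hi, hL⟩, h⟩
      rw [hL.2.2.2, Nat.add_sub_cancel_left] at h
      exact h ▸ hL
    · intro hL
      refine ⟨⟨j, Nat.lt_succ_iff.1 (Finset.mem_range.1 hj), hL⟩, ?_⟩
      rw [hL.2.2.2, Nat.add_sub_cancel_left]
  · intro L hL
    obtain ⟨j, hj, hLj⟩ := hfin.mem_toFinset.1 hL
    rw [hLj.2.2.2, Nat.add_sub_cancel_left]
    exact Finset.mem_range.2 (Nat.lt_succ_iff.2 hj)

/-- Both counts of equivariant pairs with W = K^N, divided by q^(nN), form for varying N the system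
of `explorationCount.eq_of_sum_mul_prod` with r = mn + 1 - n. The hypothesis `hnm` makes this a
genuine subtraction. -/
theorem ncard_subideals {I : Submodule K (List X →₀ K)} (hI : IsLeftIdeal I)
    [FiniteDimensional K ((List X →₀ K) ⧸ I)] {n : ℕ}
    (hn : finrank K ((List X →₀ K) ⧸ I) = n) (hnm : n ≤ Fintype.card X * n + 1) (j : ℕ) :
    ((subideals I (n + j)).ncard : ℤ) =
      explorationCount (Fintype.card K) (Fintype.card X) 0 (Fintype.card X * n + 1 - n) j := by
  refine explorationCount.eq_of_sum_mul_prod Fintype.one_lt_card _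
    (fun j => ((subideals I (n + j)).ncard : ℤ)) (fun N => ?_) j
  have h := card_equivariantPairs_eq_sum (W := Fin N → K) hI
  rw [card_equivariantPairs, hn, finrank_fin_fun] at h
  have h' := congrArg (Nat.cast : ℕ → ℤ) h
  rw [Nat.cast_sum] at h'
  have hq : ((Fintype.card K : ℕ) : ℤ) ≠ 0 := by exact_mod_cast Fintype.card_ne_zero
  refine mul_right_cancel₀ (pow_ne_zero (n * N) hq) ?_
  obtain ⟨r, hr⟩ := Nat.exists_eq_add_of_le hnm
  rw [hr, Nat.add_sub_cancel_left, Finset.sum_mul]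
  refine Eq.trans ?_ (h'.symm.trans ?_)
  · refine Finset.sum_congr rfl fun k hk => ?_
    have hk' : k ≤ N := Nat.lt_succ_iff.1 (Finset.mem_range.1 hk)
    rw [equivariantPairsWithKerCard, Finset.prod_range]
    push_cast
    rw [Finset.prod_congr rfl fun i _ => Nat.cast_sub (Nat.pow_le_pow_right
      Fintype.card_pos (i.2.le.trans hk'))]
    push_cast
    ring
  · push_cast
    rw [← pow_mul, ← pow_mul, ← pow_add, ← pow_add, ← pow_add]
    congr 1
    calc _ = N * (Fintype.card X * n + 1) + N * N * Fintype.card X := by ring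
      _ = _ := by
        rw [hr]
        ring

end Fintype

end NCSeries

/-! ### Counting rational series -/

namespace NCSeries

open Module

variable {K X : Type*} [Field K]

/-- The action of the free algebra on a series by shifts. -/
noncomputable def shiftAction (A : NCSeries K X) : (List X →₀ K) →ₗ[K] NCSeries K X :=
  Finsupp.linearCombination K fun T => shift T A

theorem shiftAction_single (A : NCSeries K X) (T : List X) :
    shiftAction A (Finsupp.single T 1) = shift T A := by
  rw [shiftAction, Finsupp.linearCombination_single, one_smul]

theorem shiftAction_letterMul (A : NCSeries K X) (x : X) (v : List X →₀ K) :
    shiftAction A (letterMul K x v) = letterShift x (shiftAction A v) := by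
  have h : shiftAction A ∘ₗ letterMul K x = letterShift x ∘ₗ shiftAction A := by
    refine Finsupp.lhom_ext' fun w => LinearMap.ext_ring ?_
    change shiftAction A (letterMul K x (Finsupp.single w 1)) =
      letterShift x (shiftAction A (Finsupp.single w 1))
    rw [letterMul_single, shiftAction_single, shiftAction_single, shift_cons]
  exact LinearMap.congr_fun h v

theorem range_shiftAction (A : NCSeries K X) : LinearMap.range (shiftAction A) = recClosure A :=
  Finsupp.range_linearCombination K

/-- The left ideal of all elements of the free algebra that shift `A` to a constant. -/
noncomputable def annihilator (A : NCSeries K X) : Submodule K (List X →₀ K) :=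
  (Submodule.span K {(1 : NCSeries K X)}).comap (shiftAction A)

theorem isLeftIdeal_annihilator (A : NCSeries K X) : IsLeftIdeal (annihilator A) := by
  intro x v hv
  obtain ⟨c, hc⟩ := Submodule.mem_span_singleton.1 (Submodule.mem_comap.1 hv)
  rw [annihilator, Submodule.mem_comap, shiftAction_letterMul, ← hc, map_smul, letterShift_one,
    smul_zero]
  exact zero_mem _

/-- The quotient by the annihilator, as a space of series modulo constants. -/
noncomputable def quotientAnnihilatorEquiv (A : NCSeries K X) :
    ((List X →₀ K) ⧸ annihilator A) ≃ₗ[K]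
      (recClosureAddConst A).map (Submodule.span K {(1 : NCSeries K X)}).mkQ :=
  (Submodule.quotEquivOfEq _ _ (by
    rw [LinearMap.ker_comp, Submodule.ker_mkQ, annihilator])).trans
  ((LinearMap.quotKerEquivRange
    ((Submodule.span K {(1 : NCSeries K X)}).mkQ ∘ₗ shiftAction A)).trans
  (LinearEquiv.ofEq _ _ (by
    rw [LinearMap.range_comp, range_shiftAction, recClosureAddConst, Submodule.map_sup,
      Submodule.mkQ_map_self, sup_bot_eq])))

theorem finiteDimensional_quotient_annihilator_iff {A : NCSeries K X} :
    FiniteDimensional K ((List X →₀ K) ⧸ annihilator A) ↔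
      FiniteDimensional K (recClosureAddConst A) := by
  constructor
  · intro h
    have h' := (quotientAnnihilatorEquiv A).finiteDimensional
    refine Module.Finite.iff_fg.2 (Submodule.fg_of_fg_map_of_fg_inf_ker
      (Submodule.span K {(1 : NCSeries K X)}).mkQ (Module.Finite.iff_fg.1 h') ?_)
    rw [Submodule.ker_mkQ, inf_eq_right.2 le_sup_right]
    exact Submodule.fg_span_singleton _
  · intro h
    exact (quotientAnnihilatorEquiv A).symm.finiteDimensional

/-- The quotient is the space of shifts modulo constants; the line of constants accounts for the
minus one in `length`. -/
theorem finrank_quotient_annihilator {A : NCSeries K X}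
    (h : FiniteDimensional K (recClosureAddConst A)) :
    finrank K ((List X →₀ K) ⧸ annihilator A) = length A := by
  let C := Submodule.span K {(1 : NCSeries K X)}
  have hone : (1 : NCSeries K X) ≠ 0 := fun h => one_ne_zero (α := K) (congrFun h [])
  have h1 : finrank K C = 1 := finrank_span_singleton hone
  have h2 := (C.mkQ ∘ₗ (recClosureAddConst A).subtype).finrank_range_add_finrank_ker
  rw [LinearMap.range_comp, Submodule.range_subtype, LinearMap.ker_comp, Submodule.ker_mkQ,
    (Submodule.comapSubtypeEquivOfLe (p := C) (q := recClosureAddConst A)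
      le_sup_right).finrank_eq, h1, ← (quotientAnnihilatorEquiv A).finrank_eq] at h2
  rw [length, ← h2, Nat.add_sub_cancel]

/-- An element v shifts A to a constant when A vanishes on wv for all nonempty words w. Writing w =
xw', the element w'v is again in the left ideal I, so it is enough to test single letters. -/
theorem le_annihilator_iff {I : Submodule K (List X →₀ K)} (hI : IsLeftIdeal I)
    {A : NCSeries K X} : I ≤ annihilator A ↔
      ∀ x, ∀ v ∈ I, Finsupp.linearCombination K (fun w => (A w : K)) (letterMul K x v) = 0 := by
  have hnil : ∀ v, Finsupp.linearCombination K (fun w => (A w : K)) v =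
      (shiftAction A v : NCSeries K X) [] := by
    intro v
    let ev : NCSeries K X →ₗ[K] K := LinearMap.proj (R := K) (φ := fun _ : List X => K) []
    have h : Finsupp.linearCombination K (fun w => (A w : K)) = ev ∘ₗ shiftAction A := by
      refine Finsupp.lhom_ext' fun w => LinearMap.ext_ring ?_
      change Finsupp.linearCombination K (fun w => (A w : K)) (Finsupp.single w 1) =
        ev (shiftAction A (Finsupp.single w 1))
      rw [shiftAction_single, Finsupp.linearCombination_single, one_smul]
      rfl
    exact LinearMap.congr_fun h v
  constructor
  · intro h x v hv
    obtain ⟨c, hc⟩ := Submodule.mem_span_singleton.1 (Submodule.mem_comap.1 (h hv))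
    rw [hnil, shiftAction_letterMul, ← hc, map_smul, letterShift_one, smul_zero]
    rfl
  · intro h v hv
    have key : ∀ w x, ∀ v ∈ I, (shiftAction A (letterMul K x v) : NCSeries K X) w = 0 := by
      intro w
      induction w using List.reverseRecOn with
      | nil =>
        intro x v hv
        rw [← hnil, h x v hv]
      | append_singleton w y ih =>
        intro x v hv
        have h := ih y _ (hI x v hv)
        rwa [shiftAction_letterMul, letterShift_apply] at h
    refine Submodule.mem_comap.2 (Submodule.mem_span_singleton.2
      ⟨(shiftAction A v : NCSeries K X) [], ?_⟩)
    ext w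
    rw [smul_apply]
    rcases List.eq_nil_or_concat' w with rfl | ⟨w, y, rfl⟩
    · rw [one_nil, mul_one]
    · have h1 : (1 : NCSeries K X) (w ++ [y]) = 0 := by cases w <;> rfl
      have h := key w y v hv
      rw [shiftAction_letterMul, letterShift_apply] at h
      rw [h, h1, mul_zero]

/-- The series with constant coefficient `1` whose other coefficients are given by functionals on a
quotient of the free algebra. -/
noncomputable def ofFunctionals (I : Submodule K (List X →₀ K))
    (c : X → ((List X →₀ K) ⧸ I) →ₗ[K] K) : NCSeries K X
  | [] => 1
  | x :: w => c x (I.mkQ (Finsupp.single w 1))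

theorem linearCombination_ofFunctionals (I : Submodule K (List X →₀ K))
    (c : X → ((List X →₀ K) ⧸ I) →ₗ[K] K) (x : X) :
    Finsupp.linearCombination K (fun w => (ofFunctionals I c w : K)) ∘ₗ letterMul K x =
      c x ∘ₗ I.mkQ := by
  refine Finsupp.lhom_ext' fun w => LinearMap.ext_ring ?_
  change Finsupp.linearCombination K (fun w => (ofFunctionals I c w : K))
    (letterMul K x (Finsupp.single w 1)) = c x (I.mkQ (Finsupp.single w 1))
  rw [letterMul_single, Finsupp.linearCombination_single, one_smul]
  rfl

/-- The series with constant coefficient `1` that are annihilated by `I` modulo constants. -/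
noncomputable def annihilatedEquiv {I : Submodule K (List X →₀ K)} (hI : IsLeftIdeal I) :
    (X → ((List X →₀ K) ⧸ I) →ₗ[K] K) ≃ {A : NCSeries K X // A [] = 1 ∧ I ≤ annihilator A} :=
  Equiv.ofBijective (fun c => ⟨ofFunctionals I c, rfl, (le_annihilator_iff hI).2 fun x v hv => by
    have h := LinearMap.congr_fun (linearCombination_ofFunctionals I c x) v
    rw [LinearMap.comp_apply, LinearMap.comp_apply, Submodule.mkQ_apply,
      (Submodule.Quotient.mk_eq_zero I).2 hv, map_zero] at h
    exact h⟩) <| by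
  constructor
  · intro c c' h
    refine funext fun x => I.linearMap_qext ?_
    have h' : ofFunctionals I c = ofFunctionals I c' := Subtype.ext_iff.1 h
    rw [← linearCombination_ofFunctionals, h', linearCombination_ofFunctionals]
  · rintro ⟨A, hA, hIA⟩
    -- The functional attached to x is v ↦ A(xv), with A extended linearly from words.
    refine ⟨fun x => I.liftQ (Finsupp.linearCombination K (fun w => (A w : K)) ∘ₗ letterMul K x)
      ((le_annihilator_iff hI).1 hIA x), Subtype.ext (NCSeries.ext fun w => ?_)⟩
    cases w with
    | nil => exact hA.symm
    | cons x w =>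
      change Finsupp.linearCombination K (fun w => (A w : K))
        (letterMul K x (Finsupp.single w 1)) = A (x :: w)
      rw [letterMul_single, Finsupp.linearCombination_single, one_smul]

variable (K X) in
/-- The recognizable series with constant coefficient `1` and length `n`. -/
def recognizableOfLength (n : ℕ) : Set (NCSeries K X) :=
  {A | A [] = 1 ∧ FiniteDimensional K (recClosureAddConst A) ∧ length A = n}

theorem annihilator_mem_subideals {n : ℕ} {A : NCSeries K X}
    (hA : A ∈ recognizableOfLength K X n) : annihilator A ∈ subideals ⊤ n :=
  ⟨isLeftIdeal_annihilator A, le_top, finiteDimensional_quotient_annihilator_iff.2 hA.2.1,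
    (finrank_quotient_annihilator hA.2.1).trans hA.2.2⟩

theorem mem_recognizableOfLength_of_le {n : ℕ} {I : Submodule K (List X →₀ K)} {A : NCSeries K X}
    (hI : I ∈ subideals ⊤ n) (hA : A [] = 1) (hIA : I ≤ annihilator A) :
    ∃ j ≤ n, A ∈ recognizableOfLength K X j := by
  obtain ⟨-, -, hfin, hn⟩ := hI
  have hsurj := Submodule.factor_surjective hIA
  have h := finiteDimensional_quotient_annihilator_iff.1
    (Module.Finite.of_surjective (Submodule.factor hIA) hsurj)
  refine ⟨_, ?_, hA, h, rfl⟩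
  rw [← finrank_quotient_annihilator h, ← hn]
  exact LinearMap.finrank_le_finrank_of_surjective hsurj

theorem finrank_quotient_top : finrank K ((List X →₀ K) ⧸ (⊤ : Submodule K (List X →₀ K))) = 0 :=
  finrank_zero_of_subsingleton

/-! ### Double counting of pairs of a left ideal and a series. -/

section Fintype

variable [Fintype K] [Fintype X]

theorem finite_subideals_top (n : ℕ) :
    (subideals (⊤ : Submodule K (List X →₀ K)) n).Finite := by
  have h := finite_subideals (I := (⊤ : Submodule K (List X →₀ K))) n
  rwa [finrank_quotient_top, zero_add] at h

theorem ncard_subideals_top (n : ℕ) :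
    ((subideals (⊤ : Submodule K (List X →₀ K)) n).ncard : ℤ) =
      explorationCount (Fintype.card K) (Fintype.card X) 0 1 n := by
  have h := ncard_subideals (I := (⊤ : Submodule K (List X →₀ K))) (fun _ _ _ => Submodule.mem_top)
    finrank_quotient_top (by simp) n
  simpa using h

theorem finite_annihilated {n : ℕ} {I : Submodule K (List X →₀ K)} (hI : I ∈ subideals ⊤ n) :
    Finite {A : NCSeries K X // A [] = 1 ∧ I ≤ annihilator A} := by
  have := hI.2.2.1
  have : Finite (((List X →₀ K) ⧸ I) →ₗ[K] K) := FiniteField.finite_linearMap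
  exact Finite.of_equiv _ (annihilatedEquiv hI.1)

theorem card_annihilated {n : ℕ} {I : Submodule K (List X →₀ K)} (hI : I ∈ subideals ⊤ n) :
    Nat.card {A : NCSeries K X // A [] = 1 ∧ I ≤ annihilator A} =
      Fintype.card K ^ (Fintype.card X * n) := by
  have := hI.2.2.1
  rw [← Nat.card_congr (annihilatedEquiv hI.1), Nat.card_fun, FiniteField.card_linearMap,
    hI.2.2.2, finrank_self, mul_one, Nat.card_eq_fintype_card, ← pow_mul, mul_comm]

theorem finite_recognizableOfLength (n : ℕ) : (recognizableOfLength K X n).Finite := by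
  refine ((finite_subideals_top (K := K) (X := X) n).biUnion
    (t := fun I => {A : NCSeries K X | A [] = 1 ∧ I ≤ annihilator A})
    fun I hI => finite_annihilated hI).subset fun A hA => ?_
  exact Set.mem_biUnion (annihilator_mem_subideals hA) ⟨hA.1, le_rfl⟩

theorem ncard_subideals_annihilator [Nonempty X] {n j : ℕ} (hj : j ≤ n) {A : NCSeries K X}
    (hA : A ∈ recognizableOfLength K X j) : ((subideals (annihilator A) n).ncard : ℤ) =
      explorationCount (Fintype.card K) (Fintype.card X) 0 (Fintype.card X * j + 1 - j) (n - j) := by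
  obtain ⟨hI, -, hfin, hdim⟩ := annihilator_mem_subideals hA
  rw [← ncard_subideals hI hdim, Nat.add_sub_cancel' hj]
  -- A nonempty alphabet ensures j ≤ mj + 1, so that the subtraction is not truncated.
  have h : 1 * j ≤ Fintype.card X * j := Nat.mul_le_mul_right j Fintype.card_pos
  omega

/-- The recursion that determines the number of recognizable series of given length. -/
theorem sum_ncard_recognizableOfLength_mul [Nonempty X] (n : ℕ) :
    ∑ j ∈ Finset.range (n + 1), ((recognizableOfLength K X j).ncard : ℤ) *
      explorationCount (Fintype.card K) (Fintype.card X) 0 (Fintype.card X * j + 1 - j) (n - j) =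
      (Fintype.card K : ℤ) ^ (Fintype.card X * n) *
        explorationCount (Fintype.card K) (Fintype.card X) 0 1 n := by
  classical
  let sI := (finite_subideals_top (K := K) (X := X) n).toFinset
  let sA := (Finset.range (n + 1)).biUnion fun j =>
    (finite_recognizableOfLength (K := K) (X := X) j).toFinset
  have hsI : ∀ {I}, I ∈ sI ↔ I ∈ subideals (⊤ : Submodule K (List X →₀ K)) n :=
    Set.Finite.mem_toFinset _
  have hsA : ∀ {A}, A ∈ sA ↔ ∃ j ≤ n, A ∈ recognizableOfLength K X j := by
    intro A
    simp [sA]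
  have hdouble := Finset.sum_card_bipartiteAbove_eq_sum_card_bipartiteBelow (s := sI) (t := sA)
    (fun I A => I ≤ annihilator A)
  have h1 : ∀ I ∈ sI, (sA.bipartiteAbove (fun I A => I ≤ annihilator A) I).card =
      Fintype.card K ^ (Fintype.card X * n) := by
    intro I hI
    rw [← card_annihilated (hsI.1 hI)]
    refine (Nat.subtype_card _ fun A => ?_).symm
    rw [Finset.mem_bipartiteAbove, hsA]
    constructor
    · rintro ⟨⟨j, -, hA⟩, h⟩
      exact ⟨hA.1, h⟩
    · rintro ⟨hA, h⟩
      exact ⟨mem_recognizableOfLength_of_le (hsI.1 hI) hA h, h⟩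
  have h2 : ∀ A ∈ sA, (sI.bipartiteBelow (fun I A => I ≤ annihilator A) A).card =
      (subideals (annihilator A) n).ncard := by
    intro A _
    refine (Nat.subtype_card _ fun I => ?_).symm
    rw [Finset.mem_bipartiteBelow, hsI]
    constructor
    · rintro ⟨⟨h, -, h'⟩, hIA⟩
      exact ⟨h, hIA, h'⟩
    · rintro ⟨h, hIA, h'⟩
      exact ⟨⟨h, le_top, h'⟩, hIA⟩
  rw [Finset.sum_congr rfl h1, Finset.sum_congr rfl h2, Finset.sum_const, smul_eq_mul,
    ← Set.ncard_eq_toFinset_card _ (finite_subideals_top n), Finset.sum_biUnion] at hdouble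
  · have h := congrArg (Nat.cast : ℕ → ℤ) hdouble
    push_cast at h
    rw [ncard_subideals_top, mul_comm] at h
    rw [h]
    refine Finset.sum_congr rfl fun j hj => ?_
    rw [Finset.sum_congr rfl fun A hA => ncard_subideals_annihilator
      (Nat.lt_succ_iff.1 (Finset.mem_range.1 hj)) ((Set.Finite.mem_toFinset _).1 hA),
      Finset.sum_const, nsmul_eq_mul,
      ← Set.ncard_eq_toFinset_card _ (finite_recognizableOfLength j)]
  · intro i _ j _ hij
    refine Finset.disjoint_left.2 fun A hA hA' => hij ?_
    rw [← ((Set.Finite.mem_toFinset _).1 hA).2.2, ← ((Set.Finite.mem_toFinset _).1 hA').2.2]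

end Fintype

end NCSeries

/-! ### The generating function -/

/-- Convergence is coefficientwise, and by `h` each coefficient receives only finitely many nonzero
terms. -/
theorem PowerSeries.hasSum_C_mul_X_pow {ι : Type*} {a : ι → ℤ} {d : ι → ℕ}
    (h : ∀ n, {i | d i = n}.Finite) :
    HasSum (fun i => PowerSeries.C (a i) * (PowerSeries.X : PowerSeries ℤ) ^ d i)
      (PowerSeries.mk fun n => ∑ i ∈ (h n).toFinset, a i) := by
  rw [PowerSeries.WithPiTopology.hasSum_iff_hasSum_coeff]
  intro n
  have hc : ∀ i, PowerSeries.coeff n (PowerSeries.C (a i) * (PowerSeries.X : PowerSeries ℤ) ^ d i) =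
      if d i = n then a i else 0 := by
    intro i
    rw [PowerSeries.coeff_C_mul, PowerSeries.coeff_X_pow]
    simp [eq_comm]
  simp only [hc, PowerSeries.coeff_mk]
  rw [Finset.sum_congr rfl fun i hi =>
    (if_pos ((Set.Finite.mem_toFinset (h n)).1 hi) : (if d i = n then a i else 0) = a i).symm]
  exact hasSum_sum_of_ne_finset_zero fun i hi =>
    if_neg fun hi' => hi ((Set.Finite.mem_toFinset (h n)).2 hi')

namespace FullTree

variable {X : Type*} [LinearOrder X]

theorem Fsum_eval_zero [Fintype X] (q : ℤ) : (Fsum X 0).eval q = 1 := by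
  classical
  have h := sum_F_eval_mul (trivial X) q
  rw [Fsum_eval, treesWithCard_zero, Finset.sum_singleton]
  simpa [interior_trivial, treesWithCard_zero, Finset.filter_singleton, countBelow] using h

theorem Fsum_eval_succ [Finite X] [IsEmpty X] (q : ℤ) (n : ℕ) : (Fsum X (n + 1)).eval q = 0 := by
  rw [Fsum_eval]
  refine Finset.sum_eq_zero fun T hT => ?_
  have h : T.interior = ∅ := Finset.eq_empty_of_forall_notMem fun w hw =>
    isEmptyElim (mem_interior.1 hw).choose
  simp [mem_treesWithCard, h] at hT

end FullTree

namespace NCSeries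

variable {K X : Type*} [Field K]

theorem length_one : length (1 : NCSeries K X) = 0 := by
  have h : recClosureAddConst (1 : NCSeries K X) = Submodule.span K {1} := by
    refine sup_eq_right.2 (Submodule.span_le.2 ?_)
    rintro _ ⟨T, rfl⟩
    change shift T (1 : NCSeries K X) ∈ Submodule.span K {1}
    induction T with
    | nil =>
      rw [shift_nil]
      exact Submodule.subset_span rfl
    | cons x T ih =>
      obtain ⟨c, hc⟩ := Submodule.mem_span_singleton.1 ih
      rw [shift_cons, ← hc, map_smul, letterShift_one, smul_zero]
      exact zero_mem _
  have hone : (1 : NCSeries K X) ≠ 0 := fun h => one_ne_zero (α := K) (congrFun h [])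
  rw [length, h, finrank_span_singleton hone]

theorem ncard_recognizableOfLength [Fintype K] [Fintype X] [LinearOrder X] (n : ℕ) :
    ((recognizableOfLength K X n).ncard : ℤ) =
      (FullTree.Fsum X n).eval (Fintype.card K : ℤ) := by
  -- The recursions need a letter. Over the empty alphabet, the only series with constant
  -- coefficient 1 is 1 and the only tree is the root.
  cases isEmpty_or_nonempty X with
  | inl hX =>
    have hone : ∀ A : NCSeries K X, A [] = 1 → A = 1 := fun A hA => by
      ext w
      cases w with
      | nil => exact hA
      | cons x w => exact isEmptyElim x
    cases n with
    | zero =>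
      have h : recognizableOfLength K X 0 = {1} := by
        refine Set.eq_singleton_iff_unique_mem.2 ⟨⟨rfl, ?_, length_one⟩, fun A hA => hone A hA.1⟩
        exact isRecognizable_iff.1 (by simpa using isRecognizable_smul_one (X := X) (1 : K))
      rw [h, Set.ncard_singleton, FullTree.Fsum_eval_zero, Nat.cast_one]
    | succ n =>
      have h : recognizableOfLength K X (n + 1) = ∅ := by
        refine Set.eq_empty_of_forall_notMem fun A hA => ?_
        have hlen := hA.2.2
        rw [hone A hA.1, length_one] at hlen
        omega
      rw [h, Set.ncard_empty, FullTree.Fsum_eval_succ, Nat.cast_zero]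
  | inr hX =>
    induction n using Nat.strong_induction_on with
    | _ n ih =>
      have h := sum_ncard_recognizableOfLength_mul (K := K) (X := X) n
      -- Both recursions have the same right-hand side; the lower terms agree by induction and the
      -- top term has coefficient E(r, 0) = 1.
      rw [← FullTree.sum_Fsum_eval_mul, Finset.sum_range_succ, Finset.sum_range_succ,
        Finset.sum_congr rfl fun j hj => by rw [ih j (Finset.mem_range.1 hj)], add_right_inj,
        Nat.sub_self, explorationCount.apply_zero] at h
      simpa using h

theorem specialRationalUnits_coe_injective :
    Function.Injective fun A : specialRationalUnits K X => (A.1 : NCSeries K X) :=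
  Units.val_injective.comp Subtype.val_injective

theorem finiteDimensional_recClosureAddConst (A : specialRationalUnits K X) :
    FiniteDimensional K (recClosureAddConst (A.1 : NCSeries K X)) :=
  isRecognizable_iff.1 (isRecognizable_of_mem_rational A.2.1)

/-- Invertibility is automatic for constant coefficient 1, and rational means recognizable. -/
theorem image_specialRationalUnits [Fintype X] (n : ℕ) :
    (fun A : specialRationalUnits K X => (A.1 : NCSeries K X)) ''
      {A | length (A.1 : NCSeries K X) = n} = recognizableOfLength K X n := by
  ext A
  constructor
  · rintro ⟨B, hB, rfl⟩
    exact ⟨B.2.2, finiteDimensional_recClosureAddConst B, hB⟩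
  · rintro ⟨hA, hfin, hlen⟩
    obtain ⟨u, rfl⟩ := isUnit_of_nil_eq_one hA
    exact ⟨⟨u, mem_rational_iff.2 (isRecognizable_iff.2 hfin), hA⟩, hlen, rfl⟩

end NCSeries

theorem mainTheorem8 {X : Type*} [Fintype X] [LinearOrder X] {K : Type*} [Field K] [Fintype K] :
    (∀ A : NCSeries.specialRationalUnits K X,
      FiniteDimensional K (NCSeries.recClosureAddConst (A.1 : NCSeries K X))) ∧
    Summable (fun A : NCSeries.specialRationalUnits K X =>
      (PowerSeries.X : PowerSeries ℤ) ^ NCSeries.length (A.1 : NCSeries K X)) ∧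
    Summable (fun T : FullTree X =>
      PowerSeries.C ((FullTree.F T).eval (Fintype.card K : ℤ)) * PowerSeries.X ^ T.interior.card) ∧
    ∑' A : NCSeries.specialRationalUnits K X,
      (PowerSeries.X : PowerSeries ℤ) ^ NCSeries.length (A.1 : NCSeries K X) =
    ∑' T : FullTree X,
      PowerSeries.C ((FullTree.F T).eval (Fintype.card K : ℤ)) * PowerSeries.X ^ T.interior.card ∧
    ∀ n : ℕ,
      {A : NCSeries.specialRationalUnits K X |
        NCSeries.length (A.1 : NCSeries K X) = n}.Finite ∧
      ({A : NCSeries.specialRationalUnits K X |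
        NCSeries.length (A.1 : NCSeries K X) = n}.ncard : ℤ) =
      (FullTree.Fsum X n).eval (Fintype.card K : ℤ) := by
  have hinj := NCSeries.specialRationalUnits_coe_injective (K := K) (X := X)
  have hfin : ∀ n, {A : NCSeries.specialRationalUnits K X |
      NCSeries.length (A.1 : NCSeries K X) = n}.Finite := fun n => by
    refine Set.Finite.of_finite_image ?_ hinj.injOn
    rw [NCSeries.image_specialRationalUnits]
    exact NCSeries.finite_recognizableOfLength n
  have hcard : ∀ n, ({A : NCSeries.specialRationalUnits K X |
      NCSeries.length (A.1 : NCSeries K X) = n}.ncard : ℤ) =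
      (FullTree.Fsum X n).eval (Fintype.card K : ℤ) := fun n => by
    rw [← Set.ncard_image_of_injective _ hinj, NCSeries.image_specialRationalUnits,
      NCSeries.ncard_recognizableOfLength]
  have hA := PowerSeries.hasSum_C_mul_X_pow (a := fun _ => 1) hfin
  simp only [map_one, one_mul] at hA
  have hT := PowerSeries.hasSum_C_mul_X_pow
    (a := fun T : FullTree X => (FullTree.F T).eval (Fintype.card K : ℤ))
    (d := fun T => T.interior.card) fun n => FullTree.finite_of_card n
  refine ⟨NCSeries.finiteDimensional_recClosureAddConst, hA.summable, hT.summable, ?_,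
    fun n => ⟨hfin n, hcard n⟩⟩
  rw [hA.tsum_eq, hT.tsum_eq]
  refine PowerSeries.ext fun n => ?_
  rw [PowerSeries.coeff_mk, PowerSeries.coeff_mk, Finset.sum_const, nsmul_eq_mul, mul_one,
    ← Set.ncard_eq_toFinset_card _ (hfin n), hcard, FullTree.Fsum_eval]
  rfl
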